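/- Let $\lambda_{\rm p},\bar m,\sigma>0$. Let $\Phi_{\rm p}$ be a homogeneous Poisson point process on $\mathbb{R}^2$ with density $\lambda_{\rm p}$. Attach to each parent $\mathbf x\in\Phi_{\rm p}$ a cluster consisting of a Poisson number (mean $\bar m$) of points $\mathbf x+\mathbf y$, where the displacements $\mathbf y$ have density $\frac{1}{2\pi\sigma^2}\exp\big(-\frac{\|\mathbf y\|^2}{2\sigma^2}\big)$ on $\mathbb{R}^2$, and all displacements, all cluster sizes and $\Phi_{\rm p}$ are independent. The union $\Psi$ of the clusters is the Thomas cluster process. For $\alpha,\beta\ge 0$ let $Q_1(\alpha,\beta)=\int_\beta^\infty y\,e^{-(y^2+\alpha^2)/2}I_0(\alpha y)\,dy$ be the Marcum $Q$-function, where $I_0$ is the modified Bessel function of the first kind of order zero, and let $f_{V_0}(v_0)=\frac{v_0}{\sigma^2}\exp\big(-\frac{v_0^2}{2\sigma^2}\big)$. Choose a cluster uniformly at random among the nonempty clusters and then choose the reference point uniformly at random among the points of that cluster. As there are infinitely many clusters, this is meant in the Palm sense: for a Borel set $A\subset\mathbb{R}^2$ of positive finite area, the probability that an event holds at the reference point is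 the expectation of the sum, over the nonempty clusters whose parent lies in $A$, of the fraction of points of the cluster at which the event holds, divided by the expected number of nonempty clusters whose parent lies in $A$ (which is positive and finite). Let $F_{R_{\rm N}^{(2)}}(r)$ be the CDF of the distance from the reference point to its nearest neighbor in $\Psi$, that is, one minus the probability that the closed disc of radius $r$ around the reference point contains exactly one point of $\Psi$ (the reference point itself). Let $F_{R_{\rm C}}(r)=\mathbb{P}(\Psi\cap \mathbf b(o,r)\neq\emptyset)$ be the CDF of the contact distance, where $\mathbf b(o,r)$ is the closed disc of radius $r$ around the origin. Then for every $r\ge 0$ and every choice of $A$, $$F_{R_{\rm N}^{(2)}}(r)=1-\big(1-F_{R_{\rm C}}(r)\big)\int_0^\infty \frac{\exp\big(\bar m\,Q_1(\frac{v_0}{\sigma},\frac r\sigma)\big)-1}{Q_1(\frac{v_0}{\sigma},\frac r\sigma)}\,\frac{e^{-\bar m}}{1-e^{-\bar m}}\,f_{V_0}(v_0)\,dv_0,$$ where $$F_{R_{\rm C}}(r)=1-\exp\Big(-2\pi\lambda_{\rm p}\int_0^\infty\Big(1-\exp\big(-\bar m\big(1-Q_1(\tfrac v\sigma,\tfrac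 r\sigma)\big)\big)\Big)v\,dv\Big),$$ and both integrals converge. -/

import Mathlib

open MeasureTheory ProbabilityTheory Set
open scoped NNReal ENNReal

/-- The Euclidean plane. -/
abbrev Plane : Type := EuclideanSpace ℝ (Fin 2)

/-- The modified Bessel function of the first kind of order zero,
`I₀(x) = ∑ₖ (x / 2) ^ (2 k) / (k!)²`. -/
noncomputable def besselIZero (x : ℝ) : ℝ :=
  ∑' k : ℕ, (x / 2) ^ (2 * k) / ((k.factorial : ℝ) ^ 2)

/-- The first-order Marcum Q-function
`Q₁(α, β) = ∫_β^∞ y exp (-(y² + α²) / 2) I₀(α y) dy`. -/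
noncomputable def marcumQ (α β : ℝ) : ℝ :=
  ∫ y in Ioi β, y * Real.exp (-(y ^ 2 + α ^ 2) / 2) * besselIZero (α * y)

/-- The Rayleigh density `f_{V₀}(v) = (v / σ²) exp (-v² / (2 σ²))`. -/
noncomputable def rayleighDensity (σ v : ℝ) : ℝ :=
  v / σ ^ 2 * Real.exp (-v ^ 2 / (2 * σ ^ 2))

/-- The symmetric normal density on the plane with variance `σ²` per coordinate. -/
noncomputable def offspringDensity (σ : ℝ) (y : Plane) : ℝ :=
  1 / (2 * Real.pi * σ ^ 2) * Real.exp (-‖y‖ ^ 2 / (2 * σ ^ 2))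

/-- The number of points of the random family `X 0, X 1, …` that lie in `B`. -/
noncomputable def pointCount {Ω : Type*} (X : ℕ → Ω → Plane) (B : Set Plane) (ω : Ω) : ℕ∞ :=
  {i : ℕ | X i ω ∈ B}.encard

/-- `X 0, X 1, …` is a measurable enumeration of a homogeneous Poisson point process of
density `lam` on the plane: the number of points in a Borel set `B` of finite area is
Poisson with mean `lam * area B`, and the numbers of points in finitely many pairwise
disjoint Borel sets are independent. -/
structure IsHomogeneousPPP {Ω : Type*} [MeasurableSpace Ω] (P : Measure Ω)
    (lam : ℝ≥0) (X : ℕ → Ω → Plane) : Prop where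
  measurable : ∀ i, Measurable (X i)
  hasLaw_count : ∀ B : Set Plane, MeasurableSet B → volume B ≠ ∞ →
    HasLaw (pointCount X B)
      ((poissonMeasure (lam * (volume B).toNNReal)).map (fun n : ℕ => (n : ℕ∞))) P
  indep_count : ∀ (n : ℕ) (B : Fin n → Set Plane), (∀ k, MeasurableSet (B k)) →
    Pairwise (fun k l => Disjoint (B k) (B l)) →
    iIndepFun (fun k => pointCount X (B k)) P

/-- The data of a Thomas cluster process on a probability space. The parents `X i` form a
homogeneous Poisson point process of density `lam`; the cluster of the parent `X i` has
`N i` points, where the `N i` are i.i.d. Poisson with mean `m`; its points are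
`X i + Y i j`, `j < N i`, where the displacements `Y i j` are i.i.d. symmetric normal with
variance `σ²`; and parents, cluster sizes and displacements are independent. -/
structure IsThomasClusterProcess {Ω : Type*} [MeasurableSpace Ω] (P : Measure Ω)
    (lam m : ℝ≥0) (σ : ℝ) (X : ℕ → Ω → Plane) (N : ℕ → Ω → ℕ) (Y : ℕ → ℕ → Ω → Plane) :
    Prop where
  parents : IsHomogeneousPPP P lam X
  measurable_size : ∀ i, Measurable (N i)
  measurable_disp : ∀ i j, Measurable (Y i j)
  hasLaw_size : ∀ i, HasLaw (N i) (poissonMeasure m) P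
  hasLaw_disp : ∀ i j, HasLaw (Y i j)
    ((volume : Measure Plane).withDensity fun y => ENNReal.ofReal (offspringDensity σ y)) P
  iIndep_size : iIndepFun N P
  iIndep_disp : iIndepFun (fun p : ℕ × ℕ => Y p.1 p.2) P
  indep_size_disp : IndepFun (fun ω i => N i ω) (fun ω i j => Y i j ω) P
  indep_parents : IndepFun (fun ω i => X i ω)
    (fun ω => ((fun i => N i ω : ℕ → ℕ), (fun i j => Y i j ω : ℕ → ℕ → Plane))) P

/-- The cluster of the `i`-th parent. -/
def cluster {Ω : Type*} (X : ℕ → Ω → Plane) (N : ℕ → Ω → ℕ) (Y : ℕ → ℕ → Ω → Plane)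
    (i : ℕ) (ω : Ω) : Set Plane :=
  {z | ∃ j, j < N i ω ∧ z = X i ω + Y i j ω}

/-- The cluster process: the union of all clusters. -/
def clusterProcess {Ω : Type*} (X : ℕ → Ω → Plane) (N : ℕ → Ω → ℕ) (Y : ℕ → ℕ → Ω → Plane)
    (ω : Ω) : Set Plane :=
  ⋃ i, cluster X N Y i ω

/-- The contact distance distribution function: the probability that the closed ball of
radius `r` around the origin contains a point of the cluster process. -/
noncomputable def contactCDF {Ω : Type*} [MeasurableSpace Ω] (P : Measure Ω)
    (X : ℕ → Ω → Plane) (N : ℕ → Ω → ℕ) (Y : ℕ → ℕ → Ω → Plane) (r : ℝ) : ℝ :=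
  P.real {ω | 0 < (clusterProcess X N Y ω ∩ Metric.closedBall 0 r).encard}

open Classical in
/-- The mean number of nonempty clusters whose parent lies in the window `A`. -/
noncomputable def meanNonemptyClusters {Ω : Type*} [MeasurableSpace Ω] (P : Measure Ω)
    (X : ℕ → Ω → Plane) (N : ℕ → Ω → ℕ) (A : Set Plane) : ℝ≥0∞ :=
  ∫⁻ ω, ∑' i : ℕ, (if X i ω ∈ A ∧ N i ω ≠ 0 then 1 else 0) ∂P

open Classical in
/-- The probability that `E` holds at the reference point, when a cluster is chosen
uniformly at random among the nonempty clusters and the reference point is chosen uniformly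
at random among the points of that cluster. As there are infinitely many clusters, "uniformly
at random" is understood in the usual (Palm) sense: the mean, over the nonempty clusters
with parent in a window `A`, of the fraction of points of the cluster at which `E` holds,
that is, the expected sum of these fractions divided by the expected number of such
clusters. -/
noncomputable def refPointProb {Ω : Type*} [MeasurableSpace Ω] (P : Measure Ω)
    (X : ℕ → Ω → Plane) (N : ℕ → Ω → ℕ) (Y : ℕ → ℕ → Ω → Plane) (A : Set Plane)
    (E : Ω → Plane → Prop) : ℝ≥0∞ :=
  (∫⁻ ω, ∑' i : ℕ, (if X i ω ∈ A ∧ N i ω ≠ 0 then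
      (∑ j ∈ Finset.range (N i ω), if E ω (X i ω + Y i j ω) then (1 : ℝ≥0∞) else 0)
        / (N i ω : ℝ≥0∞) else 0) ∂P)
    / meanNonemptyClusters P X N A

/-- The distribution function of the distance from the reference point to its nearest
neighbor: one minus the probability that the closed ball of radius `r` around the reference
point contains exactly one point of the process (the reference point itself). -/
noncomputable def nearestNeighborCDF {Ω : Type*} [MeasurableSpace Ω] (P : Measure Ω)
    (X : ℕ → Ω → Plane) (N : ℕ → Ω → ℕ) (Y : ℕ → ℕ → Ω → Plane) (A : Set Plane) (r : ℝ) : ℝ :=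
  1 - (refPointProb P X N Y A
    fun ω z => (clusterProcess X N Y ω ∩ Metric.closedBall z r).encard = 1).toReal

/-!
Write `c(w)` for the probability that a cluster point whose parent is at `w` lies outside the disc
`b(o, r)`, and `f(w) = m (1 - c(w))`. A cluster with parent at `w` has a Poisson number of
independent points, so it misses the disc with probability `exp (-f(w))`
(`lintegral_pow_poissonMeasure`, `measure_clusters_avoid`).

*Contact distance.* Given the parents, the clusters are independent, so the process misses the disc
with probability `E exp (-∑ i, f (X i))`. The Laplace functional of the Poisson process
(`laplace_functional`, from the counts for step functions by monotone approximation) evaluates this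
as `exp (-lam ∫ (1 - exp (-f)))`.

*Nearest neighbour.* Let the reference point be the `j`-th point of the `i`-th cluster, at
displacement `y` from its parent. The disc around it contains no other point when its siblings and
all other clusters avoid the disc. Given the parents and `y` these events are independent, with
probabilities `c(-y) ^ (n - 1)` for cluster size `n` and `exp (-∑ k ≠ i, f (X k - X i - y))`.
Averaging over `n` with the weight `1 / n` of a uniform choice and summing over `j` gives
`E [c ^ (n - 1); n ≠ 0] = (exp (-m (1 - c)) - exp (-m)) / c` (`siblingFactor_eq`).
In the sum over `i` the substitution `z = X i + y` turns the exponent into `∑ k ≠ i, f (X k - z)`,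
which for fixed `z` depends on the parents through one function only. So the Mecke formula is needed
only for functionals of product form (`mecke_product`), and that case follows by differentiating
the Laplace functional. By translation invariance the result is `lam * area A` times the void
probability of the whole process times the mean of the sibling factor (`mecke_displaced`). The
mean number of nonempty clusters, by which it is divided, is `lam * area A * (1 - exp (-m))`.

Finally `c(w)` is the tail of a Rice distribution. Polar coordinates and the integral representation
of `I₀` identify it with the Marcum `Q`-function at `(‖w‖ / σ, r / σ)` (`avoidProb_eq_marcumQ`), and
the remaining planar integrals are radial.
-/

/-! ### Exponentials on `[0, ∞]`, and the Laplace functional of the Poisson process -/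

/-- The decreasing exponential `x ↦ exp (-x)` on `[0, ∞]`, with `exp (-∞) = 0`. -/
noncomputable def expNeg (x : ℝ≥0∞) : ℝ≥0∞ := EReal.exp (-(x : EReal))

@[simp] lemma expNeg_zero : expNeg 0 = 1 := by simp [expNeg]

@[simp] lemma expNeg_top : expNeg ∞ = 0 := by simp [expNeg]

lemma expNeg_coe (x : ℝ≥0) : expNeg x = ENNReal.ofReal (Real.exp (-(x : ℝ))) := by
  exact EReal.exp_coe (-(x : ℝ))

lemma expNeg_ofReal {x : ℝ} (hx : 0 ≤ x) :
    expNeg (ENNReal.ofReal x) = ENNReal.ofReal (Real.exp (-x)) := by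
  rw [ENNReal.ofReal, expNeg_coe, Real.coe_toNNReal x hx]

lemma expNeg_antitone : Antitone expNeg := fun x y h => by
  rw [expNeg, expNeg, EReal.exp_le_exp_iff, EReal.neg_le_neg_iff]
  exact_mod_cast h

lemma expNeg_le_one (x : ℝ≥0∞) : expNeg x ≤ 1 := by
  simpa using expNeg_antitone (zero_le (a := x))

lemma expNeg_ne_top (x : ℝ≥0∞) : expNeg x ≠ ∞ :=
  ((expNeg_le_one x).trans_lt ENNReal.one_lt_top).ne

lemma expNeg_ne_zero {x : ℝ≥0∞} (hx : x ≠ ∞) : expNeg x ≠ 0 := by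
  lift x to ℝ≥0 using hx
  rw [expNeg_coe]
  simpa using Real.exp_pos _

lemma continuous_expNeg : Continuous expNeg :=
  ENNReal.continuous_exp.comp (continuous_neg.comp continuous_coe_ennreal_ereal)

@[fun_prop]
lemma measurable_expNeg : Measurable expNeg := continuous_expNeg.measurable

lemma expNeg_add (x y : ℝ≥0∞) : expNeg (x + y) = expNeg x * expNeg y := by
  induction x with
  | top => simp
  | coe x =>
    induction y with
    | top => simp
    | coe y =>
      rw [← ENNReal.coe_add, expNeg_coe, expNeg_coe, expNeg_coe,
        ← ENNReal.ofReal_mul (Real.exp_nonneg _), ← Real.exp_add, NNReal.coe_add, neg_add]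

lemma expNeg_sum {ι : Type*} (s : Finset ι) (f : ι → ℝ≥0∞) :
    expNeg (∑ i ∈ s, f i) = ∏ i ∈ s, expNeg (f i) := by
  classical
  induction s using Finset.induction_on with
  | empty => simp
  | insert i s hi ih => rw [Finset.sum_insert hi, Finset.prod_insert hi, expNeg_add, ih]

lemma expNeg_mul_natCast (a : ℝ≥0∞) (n : ℕ) : expNeg (a * n) = expNeg a ^ n := by
  induction n with
  | zero => simp
  | succ n ih => rw [Nat.cast_succ, mul_add, expNeg_add, ih, mul_one, pow_succ]

lemma one_sub_expNeg_ofReal {x : ℝ} (hx : 0 ≤ x) :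
    1 - expNeg (ENNReal.ofReal x) = ENNReal.ofReal (1 - Real.exp (-x)) := by
  rw [expNeg_ofReal hx, ENNReal.ofReal_sub _ (Real.exp_nonneg _), ENNReal.ofReal_one]

lemma one_sub_expNeg_le (x : ℝ≥0∞) : 1 - expNeg x ≤ x := by
  induction x with
  | top => simp
  | coe x =>
    rw [← ENNReal.ofReal_coe_nnreal, one_sub_expNeg_ofReal x.coe_nonneg]
    exact ENNReal.ofReal_le_ofReal (by linarith [Real.add_one_le_exp (-(x : ℝ))])

/-- The probability generating function of the Poisson distribution. -/
lemma lintegral_pow_poissonMeasure (μ : ℝ≥0) {c : ℝ≥0∞} (hc : c ≤ 1) :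
    ∫⁻ n, c ^ n ∂(poissonMeasure μ) = expNeg (μ * (1 - c)) := by
  lift c to ℝ≥0 using (hc.trans_lt ENNReal.one_lt_top).ne
  have hc' : (c : ℝ) ≤ 1 := by exact_mod_cast hc
  have h1 : (μ : ℝ≥0∞) * (1 - c) = ENNReal.ofReal (μ * (1 - c)) := by
    rw [ENNReal.ofReal_mul μ.coe_nonneg, ENNReal.ofReal_sub _ c.coe_nonneg]
    simp
  rw [h1, expNeg_ofReal (mul_nonneg μ.coe_nonneg (by linarith)), poissonMeasure,
    lintegral_sum_measure]
  simp only [lintegral_smul_measure, lintegral_dirac, smul_eq_mul]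
  have h2 : HasSum (fun n : ℕ => Real.exp (-μ) * (μ : ℝ) ^ n / n.factorial * (c : ℝ) ^ n)
      (Real.exp (-(μ * (1 - c)))) := by
    have := (NormedSpace.expSeries_div_hasSum_exp ((μ : ℝ) * c)).mul_left (Real.exp (-μ))
    rw [← Real.exp_eq_exp_ℝ, ← Real.exp_add] at this
    rw [show -(μ * (1 - c) : ℝ) = -μ + μ * c by ring]
    convert! this using 2 with n
    rw [mul_pow]; ring
  rw [← h2.tsum_eq, ENNReal.ofReal_tsum_of_nonneg (fun n => by positivity) h2.summable]
  refine tsum_congr fun n => ?_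
  rw [ENNReal.ofReal_mul (by positivity), ENNReal.ofReal_pow c.coe_nonneg,
    ENNReal.ofReal_coe_nnreal]

section PPP

lemma toENNReal_pointCount {Ω : Type*} (X : ℕ → Ω → Plane) (B : Set Plane) (ω : Ω) :
    (pointCount X B ω : ℝ≥0∞) = ∑' i, B.indicator 1 (X i ω) := by
  rw [pointCount, ← ENNReal.tsum_set_one, tsum_subtype {i | X i ω ∈ B} (fun _ => (1 : ℝ≥0∞))]
  rfl

variable {Ω : Type*} [MeasurableSpace Ω] {P : Measure Ω} {lam : ℝ≥0} {X : ℕ → Ω → Plane}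

lemma lintegral_comp_pointCount (h : IsHomogeneousPPP P lam X) {B : Set Plane}
    (hB : MeasurableSet B) (hB' : volume B ≠ ∞) (g : ℝ≥0∞ → ℝ≥0∞) :
    ∫⁻ ω, g (∑' i, B.indicator 1 (X i ω)) ∂P =
      ∫⁻ n : ℕ, g n ∂(poissonMeasure (lam * (volume B).toNNReal)) := by
  have := (h.hasLaw_count B hB hB').lintegral_comp (f := fun n : ℕ∞ => g n)
    (Measurable.of_discrete).aemeasurable
  simp only [toENNReal_pointCount] at this
  rw [this, lintegral_map .of_discrete .of_discrete]
  simp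

lemma laplace_count (h : IsHomogeneousPPP P lam X) {B : Set Plane}
    (hB : MeasurableSet B) (hB' : volume B ≠ ∞) (a : ℝ≥0∞) :
    ∫⁻ ω, expNeg (a * ∑' i, B.indicator 1 (X i ω)) ∂P =
      expNeg (lam * (volume B * (1 - expNeg a))) := by
  rw [lintegral_comp_pointCount h hB hB' (fun x => expNeg (a * x))]
  simp only [expNeg_mul_natCast]
  rw [lintegral_pow_poissonMeasure _ (expNeg_le_one a), ENNReal.coe_mul, ENNReal.coe_toNNReal hB',
    mul_assoc]

lemma sum_indicator_eq {α : Type*} {n : ℕ} {B : Fin n → Set α}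
    (hd : Pairwise (fun k l => Disjoint (B k) (B l))) (c : Fin n → ℝ≥0∞)
    (g : ℝ≥0∞ → ℝ≥0∞) (hg : g 0 = 0) (x : α) :
    g (∑ k, c k * (B k).indicator 1 x) = ∑ k, g (c k) * (B k).indicator 1 x := by
  by_cases hx : ∃ k, x ∈ B k
  · obtain ⟨k, hk⟩ := hx
    have hl : ∀ l, l ≠ k → x ∉ B l := fun l hl h' => disjoint_left.1 (hd hl) h' hk
    rw [Finset.sum_eq_single k, Finset.sum_eq_single k]
    · simp [hk]
    · intro l _ hlk; simp [hl l hlk]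
    · simp
    · intro l _ hlk; simp [hl l hlk]
    · simp
  · push Not at hx
    simp [hx, hg]

lemma laplace_finite (h : IsHomogeneousPPP P lam X) {n : ℕ} {B : Fin n → Set Plane}
    (hB : ∀ k, MeasurableSet (B k)) (hd : Pairwise (fun k l => Disjoint (B k) (B l)))
    (hB' : ∀ k, volume (B k) ≠ ∞) (c : Fin n → ℝ≥0∞) :
    ∫⁻ ω, expNeg (∑' i, ∑ k, c k * (B k).indicator 1 (X i ω)) ∂P =
      expNeg (lam * ∫⁻ x, (1 - expNeg (∑ k, c k * (B k).indicator 1 x))) := by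
  have hmeas := h.measurable
  have hind : iIndepFun (fun k ω => expNeg (c k * ∑' i, (B k).indicator 1 (X i ω))) P := by
    have := (h.indep_count n B hB hd).comp (fun k (m : ℕ∞) => expNeg (c k * m))
      (fun k => .of_discrete)
    convert this using 3 with k ω
    simp [toENNReal_pointCount]
  have h1 (ω : Ω) : expNeg (∑' i, ∑ k, c k * (B k).indicator 1 (X i ω)) =
      ∏ k, expNeg (c k * ∑' i, (B k).indicator 1 (X i ω)) := by
    rw [Summable.tsum_finsetSum (fun _ _ => ENNReal.summable), expNeg_sum]
    simp only [ENNReal.tsum_mul_left]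
  have hind1 (k : Fin n) : Measurable ((B k).indicator (1 : Plane → ℝ≥0∞)) :=
    measurable_one.indicator (hB k)
  simp only [h1]
  rw [lintegral_prod_eq_prod_lintegral_of_indepFun _ _ hind
    (fun k => measurable_expNeg.comp ((Measurable.tsum
      fun i => (hind1 k).comp (hmeas i)).const_mul _))]
  simp only [laplace_count h (hB _) (hB' _)]
  rw [← expNeg_sum, ← Finset.mul_sum]
  congr 2
  simp only [sum_indicator_eq hd c (fun x => 1 - expNeg x) (by simp)]
  rw [lintegral_finsetSum _ (fun k _ => (hind1 k).const_mul _)]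
  refine Finset.sum_congr rfl fun k _ => ?_
  rw [lintegral_const_mul _ (hind1 k), lintegral_indicator_one (hB k), mul_comm]

lemma laplace_simpleFunc (h : IsHomogeneousPPP P lam X) (f : SimpleFunc Plane ℝ≥0∞)
    (hf : volume (Function.support f) ≠ ∞) :
    ∫⁻ ω, expNeg (∑' i, f (X i ω)) ∂P = expNeg (lam * ∫⁻ x, (1 - expNeg (f x))) := by
  classical
  set s := f.range.filter (· ≠ 0)
  have key (x : Plane) : f x = ∑ k : Fin s.card,
      (s.equivFin.symm k : ℝ≥0∞) * (f ⁻¹' {(s.equivFin.symm k : ℝ≥0∞)}).indicator 1 x := by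
    rw [Equiv.sum_comp s.equivFin.symm (fun c : s => (c : ℝ≥0∞) *
      (f ⁻¹' {(c : ℝ≥0∞)}).indicator 1 x), Finset.sum_coe_sort s (fun c => c *
      (f ⁻¹' {c}).indicator 1 x)]
    by_cases hx : f x = 0
    · rw [hx, Finset.sum_eq_zero]
      intro c hc
      have : c ≠ 0 := (Finset.mem_filter.1 hc).2
      simp [hx, this.symm]
    · rw [Finset.sum_eq_single (f x)]
      · simp
      · intro c _ hc; simp [hc.symm]
      · intro hs; exact absurd (Finset.mem_filter.2 ⟨f.mem_range_self x, hx⟩) hs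
  simp only [key]
  refine laplace_finite h (fun k => f.measurableSet_fiber _) (fun k l hkl => ?_) (fun k => ?_) _
  · refine disjoint_left.2 fun x hk hl => hkl ?_
    apply s.equivFin.symm.injective
    ext1
    exact hk.symm.trans hl
  · refine ((measure_mono ?_).trans_lt hf.lt_top).ne
    intro x hx
    have h0 := (Finset.mem_filter.1 (s.equivFin.symm k).2).2
    rw [Function.mem_support, hx]
    exact h0

/-- The Laplace functional of a homogeneous Poisson point process. -/
theorem laplace_functional [IsProbabilityMeasure P] (h : IsHomogeneousPPP P lam X)
    {f : Plane → ℝ≥0∞} (hf : Measurable f) :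
    ∫⁻ ω, expNeg (∑' i, f (X i ω)) ∂P = expNeg (lam * ∫⁻ x, (1 - expNeg (f x))) := by
  let F (n : ℕ) : SimpleFunc Plane ℝ≥0∞ :=
    (SimpleFunc.eapprox f n).restrict (Metric.closedBall 0 n)
  have hF (n : ℕ) (x : Plane) :
      F n x = (Metric.closedBall 0 (n : ℝ)).indicator (SimpleFunc.eapprox f n) x := by
    rw [SimpleFunc.restrict_apply _ Metric.isClosed_closedBall.measurableSet]
  have hmono (x : Plane) : Monotone fun n => F n x := by
    intro n m hnm
    simp only [hF]
    refine (indicator_le_indicator_of_subset (Metric.closedBall_subset_closedBall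
      (Nat.cast_le.2 hnm)) (fun _ => zero_le) x).trans ?_
    exact indicator_le_indicator (SimpleFunc.monotone_eapprox f hnm x)
  have hlim (x : Plane) : Filter.Tendsto (fun n => F n x) Filter.atTop (nhds (f x)) := by
    have h1 := tendsto_atTop_iSup (fun n m hnm => SimpleFunc.monotone_eapprox f hnm x)
    rw [SimpleFunc.iSup_eapprox_apply hf] at h1
    refine h1.congr' ?_
    filter_upwards [Filter.eventually_ge_atTop ⌈‖x‖⌉₊] with n hn
    rw [hF, indicator_of_mem]
    rw [mem_closedBall_zero_iff]
    exact (Nat.le_ceil _).trans (by exact_mod_cast hn)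
  have hsum (ω : Ω) : Filter.Tendsto (fun n => ∑' i, F n (X i ω)) Filter.atTop
      (nhds (∑' i, f (X i ω))) := by
    have := lintegral_tendsto_of_tendsto_of_monotone (μ := Measure.count)
      (f := fun n i => F n (X i ω)) (F := fun i => f (X i ω)) (fun n => .of_discrete)
      (.of_forall fun i => hmono _) (.of_forall fun i => hlim _)
    simpa only [lintegral_count] using this
  have hm := h.measurable
  have hL : Filter.Tendsto (fun n => ∫⁻ ω, expNeg (∑' i, F n (X i ω)) ∂P) Filter.atTop
      (nhds (∫⁻ ω, expNeg (∑' i, f (X i ω)) ∂P)) := by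
    refine tendsto_lintegral_of_dominated_convergence (fun _ => 1) (fun n => ?_)
      (fun n => .of_forall fun ω => expNeg_le_one _) (by simp)
      (.of_forall fun ω => (continuous_expNeg.tendsto _).comp (hsum ω))
    exact measurable_expNeg.comp (Measurable.tsum fun i => (F n).measurable.comp (hm i))
  have hR : Filter.Tendsto (fun n => ∫⁻ x, (1 - expNeg (F n x))) Filter.atTop
      (nhds (∫⁻ x, (1 - expNeg (f x)))) := by
    refine lintegral_tendsto_of_tendsto_of_monotone (fun n => ?_) (.of_forall fun x => ?_)
      (.of_forall fun x => ?_)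
    · exact ((measurable_expNeg.comp (F n).measurable).const_sub 1).aemeasurable
    · exact fun n m hnm => tsub_le_tsub_left (expNeg_antitone (hmono x hnm)) _
    · exact ENNReal.Tendsto.sub tendsto_const_nhds ((continuous_expNeg.tendsto _).comp (hlim x))
        (.inl (by simp))
  refine tendsto_nhds_unique hL ?_
  have hn (n : ℕ) : ∫⁻ ω, expNeg (∑' i, F n (X i ω)) ∂P =
      expNeg (lam * ∫⁻ x, (1 - expNeg (F n x))) := by
    refine laplace_simpleFunc h (F n) ?_
    refine ((measure_mono (t := Metric.closedBall 0 (n : ℝ)) ?_).trans_lt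
      measure_closedBall_lt_top).ne
    intro x hx
    by_contra hx'
    exact hx (by rw [hF, indicator_of_notMem hx'])
  simp only [hn]
  exact (continuous_expNeg.tendsto _).comp
    (ENNReal.Tendsto.const_mul hR (.inr ENNReal.coe_ne_top))

end PPP

/-! ### The Mecke formula -/

lemma one_sub_expNeg_add (x y : ℝ≥0∞) :
    1 - expNeg (x + y) = (1 - expNeg x) + expNeg x * (1 - expNeg y) := by
  rw [ENNReal.mul_sub (fun _ _ => expNeg_ne_top x), mul_one, ← expNeg_add]
  exact (tsub_add_tsub_cancel (expNeg_le_one x) (expNeg_antitone le_self_add)).symm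

lemma lintegral_natCast_poissonMeasure (μ : ℝ≥0) :
    ∫⁻ n : ℕ, (n : ℝ≥0∞) ∂(poissonMeasure μ) = μ := by
  have h1 (ν : Measure ℕ) (g : ℕ → ℝ≥0∞) : ∫⁻ n, g n ∂ν = ∑' n, g n * ν {n} :=
    lintegral_countable' g
  have h2 : ∑' n, poissonMeasure μ {n} = 1 := by
    simpa using (h1 (poissonMeasure μ) 1).symm
  rw [h1, tsum_eq_zero_add' ENNReal.summable]
  simp only [Nat.cast_zero, zero_mul, zero_add]
  rw [← mul_one (μ : ℝ≥0∞), ← h2, ← ENNReal.tsum_mul_left]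
  refine tsum_congr fun n => ?_
  rw [poissonMeasure_singleton, poissonMeasure_singleton, ← ENNReal.ofReal_natCast,
    ← ENNReal.ofReal_coe_nnreal, ← ENNReal.ofReal_mul (by positivity),
    ← ENNReal.ofReal_mul (by positivity)]
  congr 1
  push_cast [Nat.factorial_succ]
  field_simp
  ring

/-- The difference quotients at `0` of `t ↦ 1 - exp (-φ t)`, along `t = 1 / (n + 1)`. -/
lemma tendsto_mul_one_sub_expNeg {φ : ℝ → ℝ} (h0 : φ 0 = 0) (hφ : ∀ t, 0 ≤ t → 0 ≤ φ t)
    {b : ℝ} (hd : HasDerivAt φ b 0) :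
    Filter.Tendsto (fun n : ℕ => ((n : ℝ≥0∞) + 1) *
      (1 - expNeg (ENNReal.ofReal (φ ((n : ℝ) + 1)⁻¹))))
      Filter.atTop (nhds (ENNReal.ofReal b)) := by
  have h1 : HasDerivAt (fun t => -Real.exp (-φ t)) b 0 := by
    convert! hd.neg.exp.neg using 1
    simp [h0]
  have h2 := h1.hasFDerivAt.lim 1 (c := fun n : ℕ => (n : ℝ) + 1) (l := Filter.atTop)
    (tendsto_norm_atTop_atTop.comp
      (Filter.tendsto_atTop_add_const_right _ _ tendsto_natCast_atTop_atTop))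
  have h3 := (ENNReal.continuous_ofReal.tendsto _).comp h2
  simp only [ContinuousLinearMap.toSpanSingleton_apply, smul_eq_mul, one_mul, mul_one,
    zero_add] at h3
  refine h3.congr fun n => ?_
  have hn : (0 : ℝ) ≤ (n : ℝ) + 1 := by positivity
  rw [one_sub_expNeg_ofReal (hφ _ (inv_nonneg.2 hn)), Function.comp_apply,
    ENNReal.ofReal_mul hn, ENNReal.ofReal_add (Nat.cast_nonneg n) zero_le_one,
    ENNReal.ofReal_natCast, ENNReal.ofReal_one, h0]
  congr 2
  simp
  ring

section Mecke

variable {Ω : Type*} [MeasurableSpace Ω] {P : Measure Ω} {lam : ℝ≥0} {X : ℕ → Ω → Plane}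

lemma lintegral_count (h : IsHomogeneousPPP P lam X) {B : Set Plane}
    (hB : MeasurableSet B) (hB' : volume B ≠ ∞) :
    ∫⁻ ω, ∑' i, B.indicator 1 (X i ω) ∂P = lam * volume B := by
  rw [lintegral_comp_pointCount h hB hB' (fun x => x), lintegral_natCast_poissonMeasure,
    ENNReal.coe_mul, ENNReal.coe_toNNReal hB']

/-- The Laplace functional at `f + t 1_S`, in its dependence on `t`. -/
lemma laplace_add_indicator [IsProbabilityMeasure P] (h : IsHomogeneousPPP P lam X)
    {f : Plane → ℝ≥0∞} (hf : Measurable f) {S : Set Plane} (hS : MeasurableSet S) (t : ℝ≥0∞) :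
    ∫⁻ ω, expNeg (t * ∑' i, S.indicator 1 (X i ω)) * expNeg (∑' i, f (X i ω)) ∂P =
      expNeg (lam * ((∫⁻ x in S, expNeg (f x)) * (1 - expNeg t))) *
        ∫⁻ ω, expNeg (∑' i, f (X i ω)) ∂P := by
  have hS1 : Measurable (S.indicator (1 : Plane → ℝ≥0∞)) := measurable_one.indicator hS
  have h1 (ω : Ω) : expNeg (t * ∑' i, S.indicator 1 (X i ω)) * expNeg (∑' i, f (X i ω)) =
      expNeg (∑' i, (f (X i ω) + t * S.indicator 1 (X i ω))) := by
    rw [ENNReal.tsum_add, ENNReal.tsum_mul_left, expNeg_add, mul_comm]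
  simp only [h1]
  rw [laplace_functional h (f := fun x => f x + t * S.indicator 1 x) (hf.add (hS1.const_mul t)),
    laplace_functional h hf, ← expNeg_add, ← mul_add, add_comm]
  congr 2
  simp only [one_sub_expNeg_add]
  rw [lintegral_add_left (by fun_prop)]
  congr 1
  rw [← lintegral_mul_const _ (by fun_prop), ← lintegral_indicator hS]
  refine lintegral_congr fun x => ?_
  by_cases hx : x ∈ S <;> simp [hx]

/-- Campbell's formula for indicators, weighted by `exp (-F)` with `F = ∑ i, f (X i)`: this is the
derivative at `t = 0` of the Laplace functional `E exp (-F - t N(S))`, where `N(S)` counts the points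
in `S`. -/
lemma lintegral_count_mul_expNeg [IsProbabilityMeasure P] (h : IsHomogeneousPPP P lam X)
    {f : Plane → ℝ≥0∞} (hf : Measurable f) {S : Set Plane} (hS : MeasurableSet S)
    (hS' : volume S ≠ ∞) :
    ∫⁻ ω, (∑' i, S.indicator 1 (X i ω)) * expNeg (∑' i, f (X i ω)) ∂P =
      lam * (∫⁻ x in S, expNeg (f x)) * ∫⁻ ω, expNeg (∑' i, f (X i ω)) ∂P := by
  have hm := h.measurable
  have hS1 : Measurable (S.indicator (1 : Plane → ℝ≥0∞)) := measurable_one.indicator hS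
  set n' : Ω → ℝ≥0∞ := fun ω => ∑' i, S.indicator 1 (X i ω) with hn'
  have hmn : Measurable n' := Measurable.tsum fun i => hS1.comp (hm i)
  have hmF : Measurable fun ω => expNeg (∑' i, f (X i ω)) :=
    measurable_expNeg.comp (Measurable.tsum fun i => hf.comp (hm i))
  have hmean : ∫⁻ ω, n' ω ∂P = lam * volume S := lintegral_count h hS hS'
  have hfin : ∫⁻ ω, n' ω ∂P ≠ ∞ := by
    rw [hmean]; exact ENNReal.mul_ne_top ENNReal.coe_ne_top hS'
  have hI : ∫⁻ x in S, expNeg (f x) ≠ ∞ := by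
    refine ne_top_of_le_ne_top hS' ?_
    calc ∫⁻ x in S, expNeg (f x) ≤ ∫⁻ x in S, 1 := lintegral_mono fun x => expNeg_le_one _
      _ = volume S := by simp
  set I := ∫⁻ x in S, expNeg (f x)
  set L := ∫⁻ ω, expNeg (∑' i, f (X i ω)) ∂P with hL
  have hL' : L ≠ ∞ := by
    rw [hL, laplace_functional h hf]; exact expNeg_ne_top _
  let t (n : ℕ) : ℝ≥0∞ := ENNReal.ofReal ((n : ℝ) + 1)⁻¹
  have ht (n : ℕ) : ((n : ℝ≥0∞) + 1) * t n = 1 := by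
    have : ((n : ℝ≥0∞) + 1) = ENNReal.ofReal ((n : ℝ) + 1) := by
      rw [ENNReal.ofReal_add (by positivity) (by positivity)]; simp
    rw [this, ← ENNReal.ofReal_mul (by positivity), mul_inv_cancel₀ (by positivity)]
    simp
  -- the difference quotients are dominated by the point count, which has finite mean
  have hlim : Filter.Tendsto (fun n : ℕ => ∫⁻ ω, (((n : ℝ≥0∞) + 1) * (1 - expNeg (t n * n' ω)))
      * expNeg (∑' i, f (X i ω)) ∂P) Filter.atTop
      (nhds (∫⁻ ω, n' ω * expNeg (∑' i, f (X i ω)) ∂P)) := by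
    refine tendsto_lintegral_of_dominated_convergence n' (fun n => ?_)
      (fun n => .of_forall fun ω => ?_) hfin ?_
    · exact (((measurable_expNeg.comp (hmn.const_mul _)).const_sub 1).const_mul _).mul hmF
    · calc ((n : ℝ≥0∞) + 1) * (1 - expNeg (t n * n' ω)) * expNeg (∑' i, f (X i ω))
          ≤ ((n : ℝ≥0∞) + 1) * (t n * n' ω) * 1 := by
            gcongr
            · exact one_sub_expNeg_le _
            · exact expNeg_le_one _
        _ = n' ω := by rw [← mul_assoc, ht, one_mul, mul_one]
    · filter_upwards [ae_lt_top hmn hfin] with ω hω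
      refine ENNReal.Tendsto.mul_const ?_ (.inr (expNeg_ne_top _))
      have := tendsto_mul_one_sub_expNeg (φ := fun s => s * (n' ω).toReal) (by simp)
        (fun s hs => by positivity) (b := (n' ω).toReal)
        (by simpa using (hasDerivAt_id (0 : ℝ)).mul_const (n' ω).toReal)
      rw [ENNReal.ofReal_toReal hω.ne] at this
      refine this.congr fun n => ?_
      rw [ENNReal.ofReal_mul (by positivity), ENNReal.ofReal_toReal hω.ne]
  refine tendsto_nhds_unique hlim ?_
  have hstep (n : ℕ) : ∫⁻ ω, (((n : ℝ≥0∞) + 1) * (1 - expNeg (t n * n' ω)))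
      * expNeg (∑' i, f (X i ω)) ∂P =
      (((n : ℝ≥0∞) + 1) * (1 - expNeg (lam * (I * (1 - expNeg (t n)))))) * L := by
    simp only [mul_assoc]
    rw [lintegral_const_mul' _ _ (by finiteness)]
    congr 1
    have hsub (a b : ℝ≥0∞) (hb : b ≠ ∞) : (1 - a) * b = b - a * b := by
      rw [ENNReal.sub_mul (fun _ _ => hb), one_mul]
    simp only [hsub _ _ (expNeg_ne_top _), hsub _ _ hL']
    rw [lintegral_sub (by fun_prop), laplace_add_indicator h hf hS]
    · rw [laplace_add_indicator h hf hS]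
      exact ENNReal.mul_ne_top (expNeg_ne_top _) hL'
    · exact .of_forall fun ω => mul_le_of_le_one_left zero_le (expNeg_le_one _)
  simp only [hstep]
  refine ENNReal.Tendsto.mul_const ?_ (.inr hL')
  have := tendsto_mul_one_sub_expNeg (φ := fun s => (lam * I.toReal) * (1 - Real.exp (-s)))
    (by simp) (fun s hs => mul_nonneg (by positivity) (by simpa using hs))
    (b := lam * I.toReal)
    (by simpa using (((hasDerivAt_id (0 : ℝ)).neg.exp.const_sub 1).const_mul (lam * I.toReal)))
  rw [ENNReal.ofReal_mul lam.coe_nonneg, ENNReal.ofReal_coe_nnreal, ENNReal.ofReal_toReal hI]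
    at this
  refine this.congr fun n => ?_
  rw [ENNReal.ofReal_mul (by positivity), ENNReal.ofReal_mul (by positivity),
    ENNReal.ofReal_coe_nnreal, ENNReal.ofReal_toReal hI,
    ← one_sub_expNeg_ofReal (by positivity), mul_assoc]

/-- Campbell's formula for the Poisson process weighted by `exp (-∑ i, f (X i))`. -/
lemma lintegral_tsum_mul_expNeg [IsProbabilityMeasure P] (h : IsHomogeneousPPP P lam X)
    {f : Plane → ℝ≥0∞} (hf : Measurable f) {k : Plane → ℝ≥0∞} (hk : Measurable k) :
    ∫⁻ ω, (∑' i, k (X i ω)) * expNeg (∑' i, f (X i ω)) ∂P =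
      lam * (∫⁻ x, k x * expNeg (f x)) * ∫⁻ ω, expNeg (∑' i, f (X i ω)) ∂P := by
  have hm := h.measurable
  have hmF : Measurable fun ω => expNeg (∑' i, f (X i ω)) :=
    measurable_expNeg.comp (Measurable.tsum fun i => hf.comp (hm i))
  set L := ∫⁻ ω, expNeg (∑' i, f (X i ω)) ∂P
  let Q : Measure Ω := P.withDensity fun ω => expNeg (∑' i, f (X i ω))
  have hQ (g : Plane → ℝ≥0∞) (hg : Measurable g) :
      ∫⁻ x, g x ∂(Measure.sum fun i => Q.map (X i)) =
        ∫⁻ ω, (∑' i, g (X i ω)) * expNeg (∑' i, f (X i ω)) ∂P := by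
    rw [lintegral_sum_measure]
    simp only [lintegral_map hg (hm _)]
    have hgX (i : ℕ) : AEMeasurable (fun ω => g (X i ω)) Q := (hg.comp (hm i)).aemeasurable
    have hgX' : Measurable fun ω => ∑' i, g (X i ω) := Measurable.tsum fun i => hg.comp (hm i)
    rw [← lintegral_tsum hgX, lintegral_withDensity_eq_lintegral_mul _ hmF hgX']
    simp only [Pi.mul_apply, mul_comm]
  have hR (g : Plane → ℝ≥0∞) (hg : Measurable g) :
      ∫⁻ x, g x ∂((lam * L) • volume.withDensity fun x : Plane => expNeg (f x)) =
        lam * (∫⁻ x, g x * expNeg (f x)) * L := by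
    rw [lintegral_smul_measure, lintegral_withDensity_eq_lintegral_mul _ (by fun_prop) hg]
    simp only [Pi.mul_apply, mul_comm (expNeg _), smul_eq_mul]
    ring
  have hμ : (Measure.sum fun i => Q.map (X i)) =
      (lam * L) • volume.withDensity fun x : Plane => expNeg (f x) := by
    refine Measure.ext_of_iUnion_eq_univ
      (s := fun n : ℕ => Metric.closedBall (0 : Plane) n)
      (Metric.iUnion_closedBall_nat 0) fun n => ?_
    ext s hs
    rw [Measure.restrict_apply hs, Measure.restrict_apply hs]
    have hs' : MeasurableSet (s ∩ Metric.closedBall (0 : Plane) n) :=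
      hs.inter Metric.isClosed_closedBall.measurableSet
    rw [← lintegral_indicator_one hs', ← lintegral_indicator_one hs',
      hQ _ (measurable_one.indicator hs'), hR _ (measurable_one.indicator hs'),
      lintegral_count_mul_expNeg h hf hs'
        ((measure_mono inter_subset_right).trans_lt measure_closedBall_lt_top).ne,
      ← lintegral_indicator hs']
    congr 2
    refine lintegral_congr fun x => ?_
    by_cases hx : x ∈ s ∩ Metric.closedBall (0 : Plane) n
    · rw [indicator_of_mem hx, indicator_of_mem hx, Pi.one_apply, one_mul]
    · rw [indicator_of_notMem hx, indicator_of_notMem hx, zero_mul]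
  rw [← hQ k hk, hμ, hR k hk]

/-- The Mecke (Slivnyak) formula for functionals of product form: seen from one of its points,
the rest of a Poisson process is distributed like the whole process. -/
theorem mecke_product [IsProbabilityMeasure P] (h : IsHomogeneousPPP P lam X)
    {f : Plane → ℝ≥0∞} (hf : Measurable f) (hf' : ∀ x, f x ≠ ∞)
    {k : Plane → ℝ≥0∞} (hk : Measurable k) :
    ∫⁻ ω, ∑' i, k (X i ω) * expNeg (∑' j, if j = i then 0 else f (X j ω)) ∂P =
      lam * (∫⁻ x, k x) * ∫⁻ ω, expNeg (∑' i, f (X i ω)) ∂P := by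
  have h0 (x : Plane) : expNeg (f x) ≠ 0 := expNeg_ne_zero (hf' x)
  have h1 := lintegral_tsum_mul_expNeg h hf (k := fun x => k x * (expNeg (f x))⁻¹)
    (by fun_prop)
  have h2 (x : Plane) : k x * (expNeg (f x))⁻¹ * expNeg (f x) = k x := by
    rw [mul_assoc, ENNReal.inv_mul_cancel (h0 x) (expNeg_ne_top _), mul_one]
  simp only [h2] at h1
  rw [← h1]
  refine lintegral_congr fun ω => ?_
  rw [← ENNReal.tsum_mul_right]
  refine tsum_congr fun i => ?_
  rw [ENNReal.tsum_eq_add_tsum_ite (f := fun j => f (X j ω)) i, expNeg_add, ← mul_assoc, h2]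
  congr!

end Mecke

/-! ### Clusters with fixed parents -/

section Independence

variable {Ω : Type*} [MeasurableSpace Ω] {P : Measure Ω}

/-- Independent random variables may be realized on two copies of the probability space. -/
lemma lintegral_indepFun [IsProbabilityMeasure P] {α β : Type*} [MeasurableSpace α]
    [MeasurableSpace β]
    {U : Ω → α} {V : Ω → β} (hU : Measurable U) (hV : Measurable V) (h : IndepFun U V P)
    {g : α → β → ℝ≥0∞} (hg : Measurable fun p : α × β => g p.1 p.2) :
    ∫⁻ ω, g (U ω) (V ω) ∂P = ∫⁻ ω, ∫⁻ ω', g (U ω) (V ω') ∂P ∂P := by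
  have h1 := h.map_prod_eq_prod_map_map hU.aemeasurable hV.aemeasurable
  have h2 : ∫⁻ ω, g (U ω) (V ω) ∂P = ∫⁻ p, g p.1 p.2 ∂(P.map fun ω => (U ω, V ω)) := by
    rw [lintegral_map hg (hU.prodMk hV)]
  have := Measure.isProbabilityMeasure_map (μ := P) hV.aemeasurable
  rw [h2, h1, lintegral_prod _ hg.aemeasurable, lintegral_map hg.lintegral_prod_right' hU]
  refine lintegral_congr fun ω => ?_
  exact lintegral_map (hg.comp measurable_prodMk_left) hV

lemma measure_forall_mem_finset {ι E : Type*} [MeasurableSpace E] {Z : ι → Ω → E}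
    (hZ : iIndepFun Z P) (T : Finset ι) {C : ι → Set E} (hC : ∀ p, MeasurableSet (C p)) :
    P {ω | ∀ p ∈ T, Z p ω ∈ C p} = ∏ p ∈ T, P {ω | Z p ω ∈ C p} := by
  have := hZ.measure_inter_preimage_eq_mul T (sets := C) (fun p _ => hC p)
  rw [show {ω | ∀ p ∈ T, Z p ω ∈ C p} = ⋂ p ∈ T, Z p ⁻¹' C p by ext; simp, this]
  rfl

/-- Conditioning on one member of an independent family. -/
lemma measure_forall_mem_finset_of_notMem [IsProbabilityMeasure P] {ι E : Type*}
    [MeasurableSpace E]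
    {Z : ι → Ω → E} (hZ : iIndepFun Z P) (hm : ∀ p, Measurable (Z p)) {T : Finset ι} {q : ι}
    (hq : q ∉ T) {C : ι → Set (E × E)} (hC : ∀ p, MeasurableSet (C p)) :
    P {ω | ∀ p ∈ T, (Z q ω, Z p ω) ∈ C p} =
      ∫⁻ ω, ∏ p ∈ T, P {ω' | (Z q ω, Z p ω') ∈ C p} ∂P := by
  have hind : IndepFun (Z q) (fun ω (p : T) => Z p ω) P := by
    have := hZ.indepFun_finset {q} T (by simpa using hq) hm
    exact this.comp (φ := fun z => z ⟨q, Finset.mem_singleton_self q⟩) (ψ := id)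
      (measurable_pi_apply (X := fun _ : ({q} : Finset ι) => E) _) measurable_id
  have hmV : Measurable (fun ω (p : T) => Z p ω) := measurable_pi_lambda _ fun p => hm p
  have hS : MeasurableSet {z : E × (T → E) | ∀ p : T, (z.1, z.2 p) ∈ C p} := by
    have : {z : E × (T → E) | ∀ p : T, (z.1, z.2 p) ∈ C p} =
        ⋂ p : T, (fun z : E × (T → E) => (z.1, z.2 p)) ⁻¹' C p := by ext; simp
    rw [this]
    exact MeasurableSet.iInter fun p => (measurable_fst.prodMk
      ((measurable_pi_apply p).comp measurable_snd)) (hC p)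
  have key := lintegral_indepFun (hm q) hmV hind
    (g := fun y z => {z : E × (T → E) | ∀ p : T, (z.1, z.2 p) ∈ C p}.indicator 1 (y, z))
    (measurable_one.indicator hS)
  have h1 : {ω | ∀ p ∈ T, (Z q ω, Z p ω) ∈ C p} = (fun ω => (Z q ω, fun p : T => Z p ω)) ⁻¹'
      {z : E × (T → E) | ∀ p : T, (z.1, z.2 p) ∈ C p} := by ext; simp
  rw [h1, ← lintegral_indicator_one (((hm q).prodMk hmV) hS)]
  refine key.trans (lintegral_congr fun ω => ?_)
  refine Eq.trans ?_ (measure_forall_mem_finset hZ T (C := fun p => {y | (Z q ω, y) ∈ C p})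
    (fun p => measurable_prodMk_left (hC p)))
  have h2 : {ω' | ∀ p ∈ T, Z p ω' ∈ {y | (Z q ω, y) ∈ C p}} =
      (fun ω' => (Z q ω, fun p : T => Z p ω')) ⁻¹'
      {z : E × (T → E) | ∀ p : T, (z.1, z.2 p) ∈ C p} := by ext; simp
  rw [h2, ← lintegral_indicator_one ((measurable_const.prodMk hmV) hS)]
  rfl

end Independence

/-- The index pairs `(i, j)` of the points of the first `M` clusters, for cluster sizes `n`. -/
def clusterIndices (n : ℕ → ℕ) (M : ℕ) : Finset (ℕ × ℕ) :=
  (Finset.range M).biUnion fun i => (Finset.range (n i)).image (Prod.mk i)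

lemma mem_clusterIndices {n : ℕ → ℕ} {M : ℕ} {p : ℕ × ℕ} :
    p ∈ clusterIndices n M ↔ p.1 < M ∧ p.2 < n p.1 := by
  obtain ⟨i, j⟩ := p
  simp [clusterIndices]

lemma prod_clusterIndices (n : ℕ → ℕ) (M : ℕ) (g : ℕ → ℝ≥0∞) :
    ∏ p ∈ clusterIndices n M, g p.1 = ∏ i ∈ Finset.range M, g i ^ n i := by
  rw [Finset.prod_finset_product (clusterIndices n M) (Finset.range M) (fun i => Finset.range (n i))
    (fun p => by simp [mem_clusterIndices])]
  simp

lemma prod_clusterIndices_erase (n : ℕ → ℕ) {M i j : ℕ} (hi : i < M) (hj : j < n i)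
    (g : ℕ → ℝ≥0∞) :
    ∏ p ∈ (clusterIndices n M).erase (i, j), g p.1 =
      g i ^ (n i - 1) * ∏ k ∈ (Finset.range M).erase i, g k ^ n k := by
  rw [Finset.prod_finset_product ((clusterIndices n M).erase (i, j)) (Finset.range M)
    (fun k => if k = i then (Finset.range (n i)).erase j else Finset.range (n k)),
    ← Finset.mul_prod_erase _ _ (Finset.mem_range.2 hi)]
  · congr 1
    · simp [hj]
    · refine Finset.prod_congr rfl fun k hk => ?_
      simp [Finset.ne_of_mem_erase hk]
  · rintro ⟨k, l⟩
    by_cases hk : k = i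
    · subst hk
      simp [mem_clusterIndices]
      tauto
    · simp [mem_clusterIndices, hk]

/-- The law of the displacements. -/
noncomputable def offspringLaw (σ : ℝ) : Measure Plane :=
  (volume : Measure Plane).withDensity fun y => ENNReal.ofReal (offspringDensity σ y)

/-- The probability that a cluster point whose parent is at `w` avoids `D`. -/
noncomputable def avoidProb (σ : ℝ) (D : Set Plane) (w : Plane) : ℝ≥0∞ :=
  offspringLaw σ {u | w + u ∉ D}

/-- The exponent of the probability that the whole cluster with parent at `w` avoids `D`. -/
noncomputable def hitExponent (m : ℝ≥0) (σ : ℝ) (D : Set Plane) (w : Plane) : ℝ≥0∞ :=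
  m * (1 - avoidProb σ D w)

instance (σ : ℝ) : SFinite (offspringLaw σ) := by
  unfold offspringLaw
  infer_instance

lemma measurable_avoidProb (σ : ℝ) {D : Set Plane} (hD : MeasurableSet D) :
    Measurable (avoidProb σ D) :=
  measurable_measure_prodMk_left (ν := offspringLaw σ)
    (s := {p : Plane × Plane | p.1 + p.2 ∉ D}) (measurable_add hD.compl)

lemma measurable_hitExponent (m : ℝ≥0) (σ : ℝ) {D : Set Plane} (hD : MeasurableSet D) :
    Measurable (hitExponent m σ D) :=
  ((measurable_avoidProb σ hD).const_sub 1).const_mul _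

lemma avoidProb_le_one (σ : ℝ) [IsProbabilityMeasure (offspringLaw σ)] (D : Set Plane)
    (w : Plane) : avoidProb σ D w ≤ 1 :=
  prob_le_one

section Cluster

variable {Ω : Type*} [MeasurableSpace Ω] {P : Measure Ω}
  {lam m : ℝ≥0} {σ : ℝ} {X : ℕ → Ω → Plane} {N : ℕ → Ω → ℕ} {Y : ℕ → ℕ → Ω → Plane}

lemma isProbabilityMeasure_offspringLaw [IsProbabilityMeasure P]
    (h : IsThomasClusterProcess P lam m σ X N Y) :
    IsProbabilityMeasure (offspringLaw σ) :=
  (h.hasLaw_disp 0 0).isProbabilityMeasure_iff.1 inferInstance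

lemma measure_disp_avoid (h : IsThomasClusterProcess P lam m σ X N Y) {D : Set Plane}
    (hD : MeasurableSet D) (w : Plane) (i j : ℕ) :
    P {ω | w + Y i j ω ∉ D} = avoidProb σ D w :=
  (h.hasLaw_disp i j).measure_eq (p := fun u => w + u ∉ D)
    ((measurable_const_add w) hD.compl)

lemma lintegral_pow_size [IsProbabilityMeasure P]
    (h : IsThomasClusterProcess P lam m σ X N Y) (D : Set Plane)
    (w : Plane) (i : ℕ) :
    ∫⁻ ω, avoidProb σ D w ^ N i ω ∂P = expNeg (hitExponent m σ D w) := by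
  have := isProbabilityMeasure_offspringLaw h
  rw [(h.hasLaw_size i).lintegral_comp (f := fun n => avoidProb σ D w ^ n)
    (Measurable.of_discrete).aemeasurable, lintegral_pow_poissonMeasure _ (avoidProb_le_one σ D w),
    hitExponent]

/-- For fixed parent locations `x`, the first `M` clusters avoid `D` with probability
`exp (-∑ i < M, hitExponent (x i))`. -/
lemma measure_clusters_avoid_range [IsProbabilityMeasure P]
    (h : IsThomasClusterProcess P lam m σ X N Y) {D : Set Plane}
    (hD : MeasurableSet D) (x : ℕ → Plane) (M : ℕ) :
    P {ω | ∀ i j, i < M → j < N i ω → x i + Y i j ω ∉ D} =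
      expNeg (∑ i ∈ Finset.range M, hitExponent m σ D (x i)) := by
  have hS : MeasurableSet {z : (ℕ → ℕ) × (ℕ → ℕ → Plane) |
      ∀ i j, i < M → j < z.1 i → x i + z.2 i j ∉ D} := by
    refine measurableSet_setOfPred.2 (Measurable.forall fun i => Measurable.forall fun j =>
      Measurable.imp measurable_const (Measurable.imp ?_ (Measurable.not ?_)))
    · exact measurableSet_setOfPred.1 (measurableSet_lt measurable_const
        ((measurable_pi_apply i).comp measurable_fst))
    · have : Measurable fun z : (ℕ → ℕ) × (ℕ → ℕ → Plane) => x i + z.2 i j := by fun_prop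
      exact measurableSet_setOfPred.1 (this hD)
  have hmN : Measurable fun ω i => N i ω := measurable_pi_lambda _ h.measurable_size
  have hmY : Measurable fun ω i j => Y i j ω :=
    measurable_pi_lambda _ fun i => measurable_pi_lambda _ fun j => h.measurable_disp i j
  have key := lintegral_indepFun hmN hmY h.indep_size_disp
    (g := fun n y => {z : (ℕ → ℕ) × (ℕ → ℕ → Plane) |
      ∀ i j, i < M → j < z.1 i → x i + z.2 i j ∉ D}.indicator 1 (n, y))
    (measurable_one.indicator hS)
  rw [show {ω | ∀ i j, i < M → j < N i ω → x i + Y i j ω ∉ D} =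
      (fun ω => (fun i => N i ω, fun i j => Y i j ω)) ⁻¹' {z : (ℕ → ℕ) × (ℕ → ℕ → Plane) |
      ∀ i j, i < M → j < z.1 i → x i + z.2 i j ∉ D} from rfl,
    ← lintegral_indicator_one ((hmN.prodMk hmY) hS)]
  refine key.trans ?_
  have hY (n : ℕ → ℕ) : P {ω | ∀ i j, i < M → j < n i → x i + Y i j ω ∉ D} =
      ∏ i ∈ Finset.range M, avoidProb σ D (x i) ^ n i := by
    have := measure_forall_mem_finset h.iIndep_disp (clusterIndices n M)
      (C := fun p => {y | x p.1 + y ∉ D}) (fun p => (measurable_const_add _) hD.compl)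
    simp only [mem_ofPred_eq, measure_disp_avoid h hD] at this
    rw [prod_clusterIndices n M (fun i => avoidProb σ D (x i))] at this
    rw [← this]
    congr 1
    ext ω
    simp [mem_clusterIndices]
  have h1 (ω : Ω) : ∫⁻ ω', {z : (ℕ → ℕ) × (ℕ → ℕ → Plane) |
      ∀ i j, i < M → j < z.1 i → x i + z.2 i j ∉ D}.indicator 1
        ((fun i => N i ω, fun i j => Y i j ω') : (ℕ → ℕ) × (ℕ → ℕ → Plane)) ∂P =
      ∏ i ∈ Finset.range M, avoidProb σ D (x i) ^ N i ω := by
    rw [← hY, ← lintegral_indicator_one]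
    · rfl
    · exact (measurable_const.prodMk hmY) hS
  simp only [h1]
  rw [lintegral_prod_eq_prod_lintegral_of_indepFun _ (fun i ω => avoidProb σ D (x i) ^ N i ω)
    (h.iIndep_size.comp (fun i k => avoidProb σ D (x i) ^ k) (fun i => .of_discrete))
    (fun i => (Measurable.of_discrete (f := fun k : ℕ => avoidProb σ D (x i) ^ k)).comp
      (h.measurable_size i))]
  rw [expNeg_sum]
  exact Finset.prod_congr rfl fun i _ => lintegral_pow_size h D (x i) i

lemma measure_clusters_avoid [IsProbabilityMeasure P]
    (h : IsThomasClusterProcess P lam m σ X N Y) {D : Set Plane}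
    (hD : MeasurableSet D) (x : ℕ → Plane) :
    P {ω | ∀ i j, j < N i ω → x i + Y i j ω ∉ D} =
      expNeg (∑' i, hitExponent m σ D (x i)) := by
  have hmeas (M : ℕ) : MeasurableSet {ω | ∀ i j, i < M → j < N i ω → x i + Y i j ω ∉ D} := by
    refine measurableSet_setOfPred.2 (Measurable.forall fun i => Measurable.forall fun j =>
      Measurable.imp measurable_const (Measurable.imp ?_ (Measurable.not ?_)))
    · exact measurableSet_setOfPred.1 (measurableSet_lt measurable_const (h.measurable_size i))
    · exact measurableSet_setOfPred.1 ((h.measurable_disp i j).const_add (x i) hD)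
  have h1 : {ω | ∀ i j, j < N i ω → x i + Y i j ω ∉ D} =
      ⋂ M, {ω | ∀ i j, i < M → j < N i ω → x i + Y i j ω ∉ D} := by
    ext ω
    simp only [mem_ofPred_eq, mem_iInter]
    exact ⟨fun H M i j _ => H i j, fun H i j => H (i + 1) i j (Nat.lt_succ_self i)⟩
  rw [h1]
  refine tendsto_nhds_unique (tendsto_measure_iInter_atTop (fun M => (hmeas M).nullMeasurableSet)
    (fun M M' hM ω hω i j hi => hω i j (hi.trans_le hM)) ⟨0, measure_ne_top _ _⟩) ?_
  refine ((continuous_expNeg.tendsto _).comp (ENNReal.tendsto_nat_tsum _)).congr fun M => ?_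
  exact (measure_clusters_avoid_range h hD x M).symm

end Cluster

/-! ### Siblings of the reference point -/

/-- The contribution of the `j`-th point to the mean fraction of the points of a cluster whose
siblings all avoid a set, each with probability `c`. The cluster size `n` is Poisson with mean `m`,
and the `j`-th point exists only if `j < n`. -/
noncomputable def siblingTerm (m : ℝ≥0) (j : ℕ) (c : ℝ≥0∞) : ℝ≥0∞ :=
  ∫⁻ n : ℕ, (if j < n then (n : ℝ≥0∞)⁻¹ * c ^ (n - 1) else 0) ∂(poissonMeasure m)

/-- The mean of `c ^ (n - 1)` on the event `n ≠ 0`, for a Poisson cluster size `n` with mean `m`. -/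
noncomputable def siblingFactor (m : ℝ≥0) (c : ℝ≥0∞) : ℝ≥0∞ :=
  ∫⁻ n : ℕ, (if n = 0 then 0 else c ^ (n - 1)) ∂(poissonMeasure m)

@[fun_prop]
lemma measurable_siblingTerm (m : ℝ≥0) (j : ℕ) : Measurable (siblingTerm m j) := by
  unfold siblingTerm
  simp only [lintegral_countable']
  refine Measurable.tsum fun n => Measurable.mul_const ?_ _
  split_ifs <;> fun_prop

@[fun_prop]
lemma measurable_siblingFactor (m : ℝ≥0) : Measurable (siblingFactor m) := by
  unfold siblingFactor
  simp only [lintegral_countable']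
  refine Measurable.tsum fun n => Measurable.mul_const ?_ _
  split_ifs <;> fun_prop

lemma tsum_siblingTerm (m : ℝ≥0) (c : ℝ≥0∞) : ∑' j, siblingTerm m j c = siblingFactor m c := by
  unfold siblingTerm siblingFactor
  rw [← lintegral_tsum fun j => Measurable.of_discrete.aemeasurable]
  refine lintegral_congr fun n => ?_
  rw [tsum_eq_sum (s := Finset.range n) fun j hj => if_neg (by simpa using hj),
    Finset.sum_congr rfl fun j hj => if_pos (Finset.mem_range.1 hj), Finset.sum_const,
    Finset.card_range, nsmul_eq_mul]
  rcases eq_or_ne n 0 with rfl | hn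
  · simp
  · rw [if_neg hn, ← mul_assoc, ENNReal.mul_inv_cancel (by simpa using hn) (by simp), one_mul]

lemma siblingFactor_le_one (m : ℝ≥0) {c : ℝ≥0∞} (hc : c ≤ 1) : siblingFactor m c ≤ 1 := by
  calc siblingFactor m c ≤ ∫⁻ n : ℕ, 1 ∂(poissonMeasure m) := by
        refine lintegral_mono fun n => ?_
        split_ifs
        · exact zero_le
        · exact pow_le_one' hc _
    _ = 1 := by simp

lemma siblingTerm_le_one (m : ℝ≥0) (j : ℕ) {c : ℝ≥0∞} (hc : c ≤ 1) : siblingTerm m j c ≤ 1 :=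
  ((ENNReal.le_tsum j).trans_eq (tsum_siblingTerm m c)).trans (siblingFactor_le_one m hc)

lemma poissonMeasure_zero (m : ℝ≥0) : poissonMeasure m {0} = expNeg m := by
  rw [poissonMeasure_singleton, expNeg_coe]
  simp

lemma siblingFactor_eq (m : ℝ≥0) {c : ℝ≥0∞} (hc : c ≤ 1) (hc0 : c ≠ 0) :
    siblingFactor m c = (expNeg (m * (1 - c)) - expNeg m) / c := by
  have hc' : c ≠ ∞ := (hc.trans_lt ENNReal.one_lt_top).ne
  have h1 : c * siblingFactor m c + expNeg m = expNeg (m * (1 - c)) := by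
    rw [← lintegral_pow_poissonMeasure m hc, ← poissonMeasure_zero, siblingFactor,
      ← lintegral_const_mul' _ _ hc', ← lintegral_indicator_one (measurableSet_singleton 0),
      ← lintegral_add_left Measurable.of_discrete]
    refine lintegral_congr fun n => ?_
    rcases eq_or_ne n 0 with rfl | hn
    · simp
    · obtain ⟨k, rfl⟩ := Nat.exists_eq_succ_of_ne_zero hn
      simp [pow_succ, mul_comm]
  rw [ENNReal.eq_div_iff hc0 hc', ← h1, ENNReal.add_sub_cancel_right (expNeg_ne_top _)]

section Cluster

variable {Ω : Type*} [MeasurableSpace Ω] {P : Measure Ω}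
  {lam m : ℝ≥0} {σ : ℝ} {X : ℕ → Ω → Plane} {N : ℕ → Ω → ℕ} {Y : ℕ → ℕ → Ω → Plane}

lemma measurableSet_siblings_avoid {D : Set Plane} (hD : MeasurableSet D) (i j : ℕ)
    (R : ℕ → Prop) :
    MeasurableSet {z : (ℕ → Plane) × (ℕ → ℕ) × (ℕ → ℕ → Plane) |
      ∀ k l, R k → (k, l) ≠ (i, j) → l < z.2.1 k →
        z.1 k + z.2.2 k l - (z.1 i + z.2.2 i j) ∉ D} := by
  refine measurableSet_setOfPred.2 (Measurable.forall fun k => Measurable.forall fun l =>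
    Measurable.imp measurable_const (Measurable.imp measurable_const
      (Measurable.imp ?_ (Measurable.not ?_))))
  · exact measurableSet_setOfPred.1 (measurableSet_lt measurable_const (by fun_prop))
  · have : Measurable fun z : (ℕ → Plane) × (ℕ → ℕ) × (ℕ → ℕ → Plane) =>
      z.1 k + z.2.2 k l - (z.1 i + z.2.2 i j) := by fun_prop
    exact measurableSet_setOfPred.1 (this hD)

lemma measurable_size_disp (h : IsThomasClusterProcess P lam m σ X N Y) :
    Measurable fun ω => ((fun i => N i ω : ℕ → ℕ), (fun i j => Y i j ω : ℕ → ℕ → Plane)) :=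
  (measurable_pi_lambda _ h.measurable_size).prodMk
    (measurable_pi_lambda _ fun i => measurable_pi_lambda _ fun j => h.measurable_disp i j)

open Classical in
/-- The mean, weighted by `1 / N i`, of the event that the points other than `(i, j)` of the first
`M` clusters avoid the translate of `D` to the point `(i, j)`, for fixed parent locations `x`. Given
the displacement of the point `(i, j)`, the other points avoid it independently. -/
lemma lintegral_siblings_avoid_range [IsProbabilityMeasure P]
    (h : IsThomasClusterProcess P lam m σ X N Y)
    {D : Set Plane} (hD : MeasurableSet D) (x : ℕ → Plane) {i : ℕ} (j : ℕ) {M : ℕ} (hi : i < M) :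
    ∫⁻ ω, (if j < N i ω then (N i ω : ℝ≥0∞)⁻¹ else 0) *
        (if ∀ k l, k < M → (k, l) ≠ (i, j) → l < N k ω →
          x k + Y k l ω - (x i + Y i j ω) ∉ D then 1 else 0) ∂P =
      ∫⁻ ω, siblingTerm m j (avoidProb σ D (-Y i j ω)) * expNeg (∑ k ∈ Finset.range M,
        if k = i then 0 else hitExponent m σ D (x k - x i - Y i j ω)) ∂P := by
  have hmN : Measurable fun ω i => N i ω := measurable_pi_lambda _ h.measurable_size
  have hmY : Measurable fun ω i j => Y i j ω :=
    measurable_pi_lambda _ fun i => measurable_pi_lambda _ fun j => h.measurable_disp i j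
  have hS : MeasurableSet {z : (ℕ → ℕ) × (ℕ → ℕ → Plane) |
      ∀ k l, k < M → (k, l) ≠ (i, j) → l < z.1 k → x k + z.2 k l - (x i + z.2 i j) ∉ D} :=
    (measurable_const.prodMk measurable_id : Measurable fun z : (ℕ → ℕ) × (ℕ → ℕ → Plane) =>
      (x, z)) (measurableSet_siblings_avoid hD i j (· < M))
  have hW : Measurable fun n : ℕ => if j < n then (n : ℝ≥0∞)⁻¹ else 0 := .of_discrete
  have key := lintegral_indepFun hmN hmY h.indep_size_disp
    (g := fun n y => (if j < n i then (n i : ℝ≥0∞)⁻¹ else 0) *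
      (if ∀ k l, k < M → (k, l) ≠ (i, j) → l < n k → x k + y k l - (x i + y i j) ∉ D
        then 1 else 0))
    ((hW.comp ((measurable_pi_apply i).comp measurable_fst)).mul
      (Measurable.ite hS measurable_const measurable_const))
  rw [key]
  -- the integrand, as a product over clusters of functions of the single cluster sizes
  let φ (y : Plane) (k n : ℕ) : ℝ≥0∞ :=
    if k = i then (if j < n then (n : ℝ≥0∞)⁻¹ * avoidProb σ D (-y) ^ (n - 1) else 0)
    else avoidProb σ D (x k - x i - y) ^ n
  have hinner (n : ℕ → ℕ) : ∫⁻ ω, (if j < n i then (n i : ℝ≥0∞)⁻¹ else 0) *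
      (if ∀ k l, k < M → (k, l) ≠ (i, j) → l < n k →
        x k + Y k l ω - (x i + Y i j ω) ∉ D then 1 else 0) ∂P =
      ∫⁻ ω, ∏ k ∈ Finset.range M, φ (Y i j ω) k (n k) ∂P := by
    have hprod (y : Plane) : ∏ k ∈ Finset.range M, φ y k (n k) =
        (if j < n i then (n i : ℝ≥0∞)⁻¹ * avoidProb σ D (-y) ^ (n i - 1) else 0) *
          ∏ k ∈ (Finset.range M).erase i, avoidProb σ D (x k - x i - y) ^ n k := by
      rw [← Finset.mul_prod_erase _ _ (Finset.mem_range.2 hi)]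
      congr 1
      · simp [φ]
      · refine Finset.prod_congr rfl fun k hk => ?_
        simp [φ, Finset.ne_of_mem_erase hk]
    simp only [hprod]
    by_cases hj : j < n i
    · simp only [if_pos hj]
      have hn : (n i : ℝ≥0∞)⁻¹ ≠ ∞ := by
        rw [ENNReal.inv_ne_top]; exact_mod_cast (Nat.zero_lt_of_lt hj).ne'
      simp only [mul_assoc]
      rw [lintegral_const_mul' _ _ hn, lintegral_const_mul' _ _ hn]
      congr 1
      have h1 := measure_forall_mem_finset_of_notMem h.iIndep_disp
        (fun p => h.measurable_disp p.1 p.2) (T := (clusterIndices n M).erase (i, j))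
        (q := (i, j)) (by simp)
        (C := fun p => {z : Plane × Plane | x p.1 + z.2 - (x i + z.1) ∉ D})
        (fun p => by
          have : Measurable fun z : Plane × Plane => x p.1 + z.2 - (x i + z.1) := by fun_prop
          exact this hD.compl)
      have h2 (ω : Ω) (p : ℕ × ℕ) : P {ω' | (Y i j ω, Y p.1 p.2 ω') ∈
          {z : Plane × Plane | x p.1 + z.2 - (x i + z.1) ∉ D}} =
          avoidProb σ D (x p.1 - x i - Y i j ω) := by
        rw [← measure_disp_avoid h hD _ p.1 p.2]
        congr 1
        ext ω'
        simp only [mem_ofPred_eq]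
        rw [show x p.1 + Y p.1 p.2 ω' - (x i + Y i j ω) =
          x p.1 - x i - Y i j ω + Y p.1 p.2 ω' by abel]
      simp only [h2] at h1
      have h3 (ω : Ω) := prod_clusterIndices_erase n hi hj
        (fun k => avoidProb σ D (x k - x i - Y i j ω))
      simp only [h3, sub_self, zero_sub] at h1
      rw [← h1, ← lintegral_indicator_one]
      · refine lintegral_congr fun ω => ?_
        rw [indicator_apply]
        congr 1
        simp only [mem_ofPred_eq, Finset.mem_erase, mem_clusterIndices, Prod.forall, eq_iff_iff]
        exact ⟨fun H k l ⟨hne, hk, hl⟩ => H k l hk hne hl,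
          fun H k l hk hne hl => H k l ⟨hne, hk, hl⟩⟩
      · convert (measurable_const.prodMk hmY : Measurable fun ω => (n, fun i j => Y i j ω)) hS
          using 1
        ext ω
        simp only [mem_ofPred_eq, Finset.mem_erase, mem_clusterIndices, Prod.forall, mem_preimage]
        exact ⟨fun H k l hk hne hl => H k l ⟨hne, hk, hl⟩,
          fun H k l ⟨hne, hk, hl⟩ => H k l hk hne hl⟩
    · simp [hj]
  have hφm (k : ℕ) : Measurable fun p : Plane × ℕ => φ p.1 k p.2 := by
    refine measurable_from_prod_countable_left fun n => ?_
    have := measurable_avoidProb σ hD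
    simp only [φ]
    split_ifs <;> fun_prop
  refine (lintegral_congr fun ω => hinner fun i => N i ω).trans ?_
  rw [lintegral_lintegral_swap]
  · refine lintegral_congr fun ω => ?_
    rw [lintegral_prod_eq_prod_lintegral_of_indepFun _ (fun k ω' => φ (Y i j ω) k (N k ω'))
      (h.iIndep_size.comp (fun k n => φ (Y i j ω) k n) (fun i => .of_discrete))
      (fun k => (Measurable.of_discrete (f := fun n : ℕ => φ (Y i j ω) k n)).comp
        (h.measurable_size k)), expNeg_sum, ← Finset.mul_prod_erase _ _ (Finset.mem_range.2 hi),
      ← Finset.mul_prod_erase _ (fun k => expNeg (if k = i then 0 else _))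
        (Finset.mem_range.2 hi)]
    simp only [if_true, expNeg_zero, one_mul]
    congr 1
    · simp only [φ, if_true]
      exact (h.hasLaw_size i).lintegral_comp (f := fun n : ℕ =>
        if j < n then (n : ℝ≥0∞)⁻¹ * avoidProb σ D (-Y i j ω) ^ (n - 1) else 0)
        Measurable.of_discrete.aemeasurable
    · refine Finset.prod_congr rfl fun k hk => ?_
      simp only [φ, if_neg (Finset.ne_of_mem_erase hk)]
      exact lintegral_pow_size h D _ k
  · have hk (k : ℕ) : Measurable fun p : Ω × Ω => φ (Y i j p.2) k (N k p.1) :=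
      (hφm k).comp (f := fun p : Ω × Ω => (Y i j p.2, N k p.1))
        (((h.measurable_disp i j).comp measurable_snd).prodMk
          ((h.measurable_size k).comp measurable_fst))
    exact (Finset.measurable_prod (Finset.range M) fun k _ => hk k).aemeasurable

open Classical in
/-- The limit `M → ∞` of `lintegral_siblings_avoid_range`. -/
lemma lintegral_siblings_avoid [IsProbabilityMeasure P]
    (h : IsThomasClusterProcess P lam m σ X N Y)
    {D : Set Plane} (hD : MeasurableSet D) (x : ℕ → Plane) (i j : ℕ) :
    ∫⁻ ω, (if j < N i ω then (N i ω : ℝ≥0∞)⁻¹ else 0) *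
        (if ∀ k l, (k, l) ≠ (i, j) → l < N k ω →
          x k + Y k l ω - (x i + Y i j ω) ∉ D then 1 else 0) ∂P =
      ∫⁻ y, siblingTerm m j (avoidProb σ D (-y)) *
        expNeg (∑' k, if k = i then 0 else hitExponent m σ D (x k - x i - y))
          ∂(offspringLaw σ) := by
  have hf := measurable_hitExponent m σ hD
  have hc := measurable_avoidProb σ hD
  have hY := h.measurable_disp i j
  have hm (k : ℕ) : Measurable fun y => if k = i then 0 else hitExponent m σ D (x k - x i - y) := by
    split_ifs <;> fun_prop
  have hR : ∫⁻ y, siblingTerm m j (avoidProb σ D (-y)) *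
        expNeg (∑' k, if k = i then 0 else hitExponent m σ D (x k - x i - y))
          ∂(offspringLaw σ) = ∫⁻ ω, siblingTerm m j (avoidProb σ D (-Y i j ω)) *
        expNeg (∑' k, if k = i then 0 else hitExponent m σ D (x k - x i - Y i j ω)) ∂P := by
    refine ((h.hasLaw_disp i j).lintegral_comp (f := fun y => siblingTerm m j (avoidProb σ D (-y)) *
      expNeg (∑' k, if k = i then 0 else hitExponent m σ D (x k - x i - y))) ?_).symm
    exact (Measurable.mul (by fun_prop)
      (measurable_expNeg.comp (Measurable.tsum hm))).aemeasurable
  rw [hR]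
  have hW : Measurable fun n : ℕ => if j < n then (n : ℝ≥0∞)⁻¹ else 0 := .of_discrete
  have hW1 (n : ℕ) : (if j < n then (n : ℝ≥0∞)⁻¹ else 0) ≤ 1 := by
    split_ifs with hj
    · exact ENNReal.inv_le_one.2 (by exact_mod_cast Nat.one_le_of_lt hj)
    · exact zero_le
  have hSω (R : ℕ → Prop) : MeasurableSet {ω | ∀ k l, R k → (k, l) ≠ (i, j) → l < N k ω →
      x k + Y k l ω - (x i + Y i j ω) ∉ D} :=
    (measurable_const.prodMk (measurable_size_disp h) : Measurable fun ω => (x, _))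
      (measurableSet_siblings_avoid hD i j R)
  have hlimL : Filter.Tendsto (fun M : ℕ => ∫⁻ ω, (if j < N i ω then (N i ω : ℝ≥0∞)⁻¹ else 0) *
        (if ∀ k l, k < M → (k, l) ≠ (i, j) → l < N k ω →
          x k + Y k l ω - (x i + Y i j ω) ∉ D then 1 else 0) ∂P) Filter.atTop
      (nhds (∫⁻ ω, (if j < N i ω then (N i ω : ℝ≥0∞)⁻¹ else 0) *
        (if ∀ k l, (k, l) ≠ (i, j) → l < N k ω →
          x k + Y k l ω - (x i + Y i j ω) ∉ D then 1 else 0) ∂P)) := by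
    refine tendsto_lintegral_of_dominated_convergence (fun _ => 1) (fun M => ?_)
      (fun M => .of_forall fun ω => ?_) (by simp) (.of_forall fun ω => ?_)
    · exact (hW.comp (h.measurable_size i)).mul
        (Measurable.ite (hSω (· < M)) measurable_const measurable_const)
    · refine mul_le_one' (hW1 _) ?_
      split_ifs <;> simp
    · refine ENNReal.Tendsto.const_mul ?_ (.inr ((hW1 _).trans_lt ENNReal.one_lt_top).ne)
      by_cases H : ∀ k l, (k, l) ≠ (i, j) → l < N k ω → x k + Y k l ω - (x i + Y i j ω) ∉ D
      · rw [if_pos H]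
        refine tendsto_const_nhds.congr fun M => ?_
        rw [if_pos fun k l _ => H k l]
      · rw [if_neg H]
        push Not at H
        obtain ⟨k, l, h1, h2, h3⟩ := H
        refine tendsto_const_nhds.congr' ?_
        filter_upwards [Filter.eventually_gt_atTop k] with M hM
        rw [if_neg fun H => H k l hM h1 h2 h3]
  refine tendsto_nhds_unique hlimL ?_
  have hlimR : Filter.Tendsto (fun M : ℕ => ∫⁻ ω, siblingTerm m j (avoidProb σ D (-Y i j ω)) *
      expNeg (∑ k ∈ Finset.range M,
        if k = i then 0 else hitExponent m σ D (x k - x i - Y i j ω)) ∂P) Filter.atTop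
      (nhds (∫⁻ ω, siblingTerm m j (avoidProb σ D (-Y i j ω)) *
        expNeg (∑' k, if k = i then 0 else hitExponent m σ D (x k - x i - Y i j ω)) ∂P)) := by
    have := isProbabilityMeasure_offspringLaw h
    have hs1 (y : Plane) := siblingTerm_le_one m j (avoidProb_le_one σ D y)
    refine tendsto_lintegral_of_dominated_convergence (fun _ => 1) (fun M => ?_)
      (fun M => .of_forall fun ω => ?_) (by simp) (.of_forall fun ω => ?_)
    · exact Measurable.mul (by fun_prop) (measurable_expNeg.comp
        (Finset.measurable_sum _ fun k _ => (hm k).comp hY))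
    · exact mul_le_one' (hs1 _) (expNeg_le_one _)
    · exact ENNReal.Tendsto.const_mul
        ((continuous_expNeg.tendsto _).comp (ENNReal.tendsto_nat_tsum _))
        (.inr ((hs1 _).trans_lt ENNReal.one_lt_top).ne)
  refine hlimR.congr' ?_
  filter_upwards [Filter.eventually_gt_atTop i] with M hM
  exact (lintegral_siblings_avoid_range h hD x j hM).symm

end Cluster

/-! ### The contact and reference point probabilities -/

section NearestNeighbor

/-- A disc around a point of the cluster process contains no other point of the process exactly
when no other index pair yields a point of the disc punctured at its centre. (Points carried by
two index pairs are harmless, since the centre is removed.) -/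
lemma encard_inter_closedBall_eq_one_iff {Ω : Type*} {X : ℕ → Ω → Plane} {N : ℕ → Ω → ℕ}
    {Y : ℕ → ℕ → Ω → Plane} {r : ℝ} (hr : 0 ≤ r) {ω : Ω} {i j : ℕ}
    (hj : j < N i ω) :
    (clusterProcess X N Y ω ∩ Metric.closedBall (X i ω + Y i j ω) r).encard = 1 ↔
      ∀ k l, (k, l) ≠ (i, j) → l < N k ω →
        X k ω + Y k l ω - (X i ω + Y i j ω) ∉ Metric.closedBall (0 : Plane) r \ {0} := by
  set z := X i ω + Y i j ω with hz
  have hzmem : z ∈ clusterProcess X N Y ω ∩ Metric.closedBall z r :=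
    ⟨mem_iUnion.2 ⟨i, j, hj, rfl⟩, Metric.mem_closedBall_self hr⟩
  rw [encard_eq_one]
  constructor
  · rintro ⟨a, ha⟩ k l - hl ⟨hb, h0⟩
    have hza : z = a := by rw [ha] at hzmem; exact hzmem
    have hmem : X k ω + Y k l ω ∈ clusterProcess X N Y ω ∩ Metric.closedBall z r :=
      ⟨mem_iUnion.2 ⟨k, l, hl, rfl⟩, by simpa [dist_eq_norm] using hb⟩
    rw [ha, ← hza] at hmem
    exact h0 (sub_eq_zero.2 hmem)
  · intro H
    refine ⟨z, Subset.antisymm ?_ (singleton_subset_iff.2 hzmem)⟩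
    rintro u ⟨hu, hur⟩
    obtain ⟨k, l, hl, rfl⟩ := mem_iUnion.1 hu
    by_contra hne
    refine H k l ?_ hl ⟨by simpa [dist_eq_norm] using hur, fun h0 => hne (sub_eq_zero.1 h0)⟩
    rintro ⟨⟩
    exact hne rfl

variable {Ω : Type*} [MeasurableSpace Ω] {P : Measure Ω}
  {lam m : ℝ≥0} {σ : ℝ} {X : ℕ → Ω → Plane} {N : ℕ → Ω → ℕ} {Y : ℕ → ℕ → Ω → Plane}

/-- The probability that the cluster process avoids `D`, in closed form; see
`measure_disjoint_clusterProcess`. -/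
noncomputable def voidProb (lam m : ℝ≥0) (σ : ℝ) (D : Set Plane) : ℝ≥0∞ :=
  expNeg (lam * ∫⁻ x, (1 - expNeg (hitExponent m σ D x)))

lemma hitExponent_ne_top (m : ℝ≥0) (σ : ℝ) (D : Set Plane) (w : Plane) :
    hitExponent m σ D w ≠ ∞ :=
  ENNReal.mul_ne_top ENNReal.coe_ne_top (ENNReal.sub_ne_top ENNReal.one_ne_top)

lemma measure_disjoint_clusterProcess [IsProbabilityMeasure P]
    (h : IsThomasClusterProcess P lam m σ X N Y) {D : Set Plane} (hD : MeasurableSet D) :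
    P {ω | ∀ i j, j < N i ω → X i ω + Y i j ω ∉ D} = voidProb lam m σ D := by
  have hX : Measurable fun ω i => X i ω := measurable_pi_lambda _ h.parents.measurable
  have hS : MeasurableSet {z : (ℕ → Plane) × (ℕ → ℕ) × (ℕ → ℕ → Plane) |
      ∀ i j, j < z.2.1 i → z.1 i + z.2.2 i j ∉ D} := by
    refine measurableSet_setOfPred.2 (Measurable.forall fun k => Measurable.forall fun l =>
      Measurable.imp ?_ (Measurable.not ?_))
    · exact measurableSet_setOfPred.1 (measurableSet_lt measurable_const (by fun_prop))
    · have : Measurable fun z : (ℕ → Plane) × (ℕ → ℕ) × (ℕ → ℕ → Plane) =>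
        z.1 k + z.2.2 k l := by fun_prop
      exact measurableSet_setOfPred.1 (this hD)
  have key := lintegral_indepFun hX (measurable_size_disp h) h.indep_parents
    (g := fun x z => {z : (ℕ → Plane) × (ℕ → ℕ) × (ℕ → ℕ → Plane) |
      ∀ i j, j < z.2.1 i → z.1 i + z.2.2 i j ∉ D}.indicator 1 (x, z))
    (measurable_one.indicator hS)
  rw [voidProb, ← laplace_functional h.parents (measurable_hitExponent m σ hD)]
  refine (lintegral_indicator_one ((hX.prodMk (measurable_size_disp h)) hS)).symm.trans
    (key.trans (lintegral_congr fun ω => ?_))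
  rw [← measure_clusters_avoid h hD]
  exact lintegral_indicator_one
    ((measurable_const.prodMk (measurable_size_disp h) : Measurable fun ω' => (_, _)) hS)

open Classical in
lemma meanNonemptyClusters_eq [IsProbabilityMeasure P]
    (h : IsThomasClusterProcess P lam m σ X N Y) {A : Set Plane} (hA : MeasurableSet A)
    (hA' : volume A ≠ ∞) :
    meanNonemptyClusters P X N A = lam * volume A * (1 - expNeg m) := by
  have hAm : Measurable (A.indicator (1 : Plane → ℝ≥0∞)) := measurable_one.indicator hA
  have hNm : Measurable fun n : ℕ => if n = 0 then (0 : ℝ≥0∞) else 1 := .of_discrete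
  have hm (i : ℕ) : Measurable fun ω =>
      A.indicator (1 : Plane → ℝ≥0∞) (X i ω) * (if N i ω = 0 then (0 : ℝ≥0∞) else 1) :=
    (hAm.comp (h.parents.measurable i)).mul (hNm.comp (h.measurable_size i))
  have h1 (ω : Ω) : (∑' i : ℕ, if X i ω ∈ A ∧ N i ω ≠ 0 then (1 : ℝ≥0∞) else 0) =
      ∑' i, A.indicator (1 : Plane → ℝ≥0∞) (X i ω) * (if N i ω = 0 then (0 : ℝ≥0∞) else 1) := by
    refine tsum_congr fun i => ?_
    by_cases hx : X i ω ∈ A <;> by_cases hn : N i ω = 0 <;> simp [hx, hn]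
  have hN (i : ℕ) : ∫⁻ ω, (if N i ω = 0 then (0 : ℝ≥0∞) else 1) ∂P = 1 - expNeg m := by
    rw [(h.hasLaw_size i).lintegral_comp (f := fun n : ℕ => if n = 0 then (0 : ℝ≥0∞) else 1)
      hNm.aemeasurable]
    have : (fun n : ℕ => if n = 0 then (0 : ℝ≥0∞) else 1) = ({0}ᶜ : Set ℕ).indicator 1 := by
      ext n; by_cases hn : n = 0 <;> simp [hn]
    rw [this, lintegral_indicator_one .of_discrete, prob_compl_eq_one_sub .of_discrete,
      poissonMeasure_zero]
  have hind (i : ℕ) : ∫⁻ ω, A.indicator (1 : Plane → ℝ≥0∞) (X i ω) *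
      (if N i ω = 0 then (0 : ℝ≥0∞) else 1) ∂P =
      (∫⁻ ω, A.indicator (1 : Plane → ℝ≥0∞) (X i ω) ∂P) * (1 - expNeg m) := by
    rw [← hN i]
    refine lintegral_mul_eq_lintegral_mul_lintegral_of_indepFun
      (hAm.comp (h.parents.measurable i)) (hNm.comp (h.measurable_size i)) ?_
    exact h.indep_parents.comp (φ := fun x : ℕ → Plane => A.indicator (1 : Plane → ℝ≥0∞) (x i))
      (ψ := fun z => if z.1 i = 0 then (0 : ℝ≥0∞) else 1)
      (hAm.comp (f := fun x : ℕ → Plane => x i) (measurable_pi_apply i))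
      (hNm.comp ((measurable_pi_apply i).comp measurable_fst))
  unfold meanNonemptyClusters
  rw [lintegral_congr h1, lintegral_tsum fun i => (hm i).aemeasurable]
  have hmX (i : ℕ) : AEMeasurable (fun ω => A.indicator (1 : Plane → ℝ≥0∞) (X i ω)) P :=
    (hAm.comp (h.parents.measurable i)).aemeasurable
  rw [tsum_congr hind, ENNReal.tsum_mul_right, ← lintegral_tsum hmX,
    lintegral_count h.parents hA hA']

@[fun_prop]
lemma measurable_offspringDensity (σ : ℝ) : Measurable (offspringDensity σ) := by
  unfold offspringDensity
  fun_prop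

open Classical in
/-- The point `(i, j)` enters the reference point probability with weight `1 / N i`. Its parent must
lie in `A`, and the other points must avoid the translate of `D` to it. The parents are integrated
last. -/
lemma lintegral_reference_point [IsProbabilityMeasure P]
    (h : IsThomasClusterProcess P lam m σ X N Y) {A : Set Plane} (hA : MeasurableSet A)
    {D : Set Plane} (hD : MeasurableSet D) (i j : ℕ) :
    ∫⁻ ω, A.indicator 1 (X i ω) * ((if j < N i ω then (N i ω : ℝ≥0∞)⁻¹ else 0) *
        (if ∀ k l, (k, l) ≠ (i, j) → l < N k ω →
          X k ω + Y k l ω - (X i ω + Y i j ω) ∉ D then 1 else 0)) ∂P =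
      ∫⁻ ω, A.indicator 1 (X i ω) * ∫⁻ y, siblingTerm m j (avoidProb σ D (-y)) *
        expNeg (∑' k, if k = i then 0 else hitExponent m σ D (X k ω - X i ω - y))
          ∂(offspringLaw σ) ∂P := by
  have hX : Measurable fun ω i => X i ω := measurable_pi_lambda _ h.parents.measurable
  have hAm : Measurable (A.indicator (1 : Plane → ℝ≥0∞)) := measurable_one.indicator hA
  have hW : Measurable fun n : ℕ => if j < n then (n : ℝ≥0∞)⁻¹ else 0 := .of_discrete
  have hS := measurableSet_siblings_avoid hD i j (fun _ => True)
  simp only [true_implies] at hS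
  refine (lintegral_indepFun hX (measurable_size_disp h) h.indep_parents
    (g := fun x z => A.indicator 1 (x i) * ((if j < z.1 i then (z.1 i : ℝ≥0∞)⁻¹ else 0) *
        (if ∀ k l, (k, l) ≠ (i, j) → l < z.1 k →
          x k + z.2 k l - (x i + z.2 i j) ∉ D then 1 else 0))) ?_).trans ?_
  · refine (hAm.comp ((measurable_pi_apply i).comp measurable_fst)).mul (Measurable.mul ?_ ?_)
    · exact hW.comp ((measurable_pi_apply i).comp (measurable_fst.comp measurable_snd))
    · exact Measurable.ite hS measurable_const measurable_const
  · refine lintegral_congr fun ω => ?_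
    have hfin : A.indicator (1 : Plane → ℝ≥0∞) (X i ω) ≠ ∞ := by
      by_cases hx : X i ω ∈ A <;> simp [hx]
    rw [lintegral_const_mul' _ _ hfin]
    congr 1
    exact lintegral_siblings_avoid h hD (fun k => X k ω) i j

/-- Mecke's formula with a displacement: the substitution `z = X i + y` makes the integrand, for
each fixed `z`, a functional of product form. -/
lemma mecke_displaced [IsProbabilityMeasure P] (h : IsHomogeneousPPP P lam X)
    {f : Plane → ℝ≥0∞} (hf : Measurable f) (hf' : ∀ x, f x ≠ ∞) {W : Plane → ℝ≥0∞}
    (hW : Measurable W) {A : Set Plane} (hA : MeasurableSet A) :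
    ∑' i, ∫⁻ ω, A.indicator 1 (X i ω) * (∫⁻ y, W y *
        expNeg (∑' k, if k = i then 0 else f (X k ω - X i ω - y))) ∂P =
      lam * volume A * expNeg (lam * ∫⁻ x, (1 - expNeg (f x))) * ∫⁻ y, W y := by
  have hXm := h.measurable
  have hAm : Measurable (A.indicator (1 : Plane → ℝ≥0∞)) := measurable_one.indicator hA
  have hmz (i : ℕ) : Measurable fun p : Plane × Ω => A.indicator 1 (X i p.2) * W (p.1 - X i p.2) *
      expNeg (∑' k, if k = i then 0 else f (X k p.2 - p.1)) := by
    refine (((hAm.comp (hXm i)).comp measurable_snd).mul (hW.comp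
      (measurable_fst.sub ((hXm i).comp measurable_snd)))).mul ?_
    refine measurable_expNeg.comp (Measurable.tsum fun k => ?_)
    split_ifs
    · exact measurable_const
    · exact hf.comp (((hXm k).comp measurable_snd).sub measurable_fst)
  have hi (i : ℕ) : ∫⁻ ω, A.indicator 1 (X i ω) * (∫⁻ y, W y *
        expNeg (∑' k, if k = i then 0 else f (X k ω - X i ω - y))) ∂P =
      ∫⁻ z, ∫⁻ ω, A.indicator 1 (X i ω) * W (z - X i ω) *
        expNeg (∑' k, if k = i then 0 else f (X k ω - z)) ∂P := by
    rw [lintegral_lintegral_swap (f := fun z ω => A.indicator 1 (X i ω) * W (z - X i ω) *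
        expNeg (∑' k, if k = i then 0 else f (X k ω - z))) (hmz i).aemeasurable]
    refine lintegral_congr fun ω => ?_
    have hfin : A.indicator (1 : Plane → ℝ≥0∞) (X i ω) ≠ ∞ := by
      by_cases hx : X i ω ∈ A <;> simp [hx]
    simp only [mul_assoc]
    rw [lintegral_const_mul' _ _ hfin, ← lintegral_sub_right_eq_self _ (X i ω)]
    simp only [sub_sub, add_sub_cancel]
  have hz (z : Plane) : ∑' i, ∫⁻ ω, A.indicator 1 (X i ω) * W (z - X i ω) *
      expNeg (∑' k, if k = i then 0 else f (X k ω - z)) ∂P =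
      lam * (∫⁻ x, A.indicator 1 x * W (z - x)) *
        expNeg (lam * ∫⁻ x, (1 - expNeg (f x))) := by
    have hmz' (i : ℕ) : AEMeasurable (fun ω => A.indicator 1 (X i ω) * W (z - X i ω) *
        expNeg (∑' k, if k = i then 0 else f (X k ω - z))) P :=
      ((hmz i).comp measurable_prodMk_left).aemeasurable
    rw [← lintegral_tsum hmz']
    refine (mecke_product h (f := fun x => f (x - z)) (by fun_prop)
      (fun x => hf' _) (k := fun x => A.indicator 1 x * W (z - x))
      (hAm.mul (hW.comp (measurable_const_sub z)))).trans ?_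
    rw [laplace_functional h (f := fun x => f (x - z)) (by fun_prop),
      lintegral_sub_right_eq_self (fun x => 1 - expNeg (f x)) z]
  have hx (x : Plane) : ∫⁻ z, A.indicator 1 x * W (z - x) = A.indicator 1 x * ∫⁻ y, W y := by
    rw [lintegral_const_mul' _ _ (by by_cases hx : x ∈ A <;> simp [hx]),
      lintegral_sub_right_eq_self W x]
  have hmi (i : ℕ) : AEMeasurable (fun z => ∫⁻ ω, A.indicator 1 (X i ω) * W (z - X i ω) *
      expNeg (∑' k, if k = i then 0 else f (X k ω - z)) ∂P) volume :=
    (Measurable.lintegral_prod_right' (ν := P) (hmz i)).aemeasurable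
  have hm2 : Measurable fun p : Plane × Plane => A.indicator 1 p.2 * W (p.1 - p.2) :=
    (hAm.comp measurable_snd).mul (hW.comp (measurable_fst.sub measurable_snd))
  rw [tsum_congr hi, ← lintegral_tsum hmi, lintegral_congr hz,
    lintegral_mul_const' _ _ (expNeg_ne_top _), lintegral_const_mul' _ _ ENNReal.coe_ne_top,
    lintegral_lintegral_swap (f := fun z x => A.indicator 1 x * W (z - x)) hm2.aemeasurable,
    lintegral_congr hx, lintegral_mul_const _ hAm, lintegral_indicator_one hA]
  ring

/-- The sum over all points `(i, j)` of the mean weights of the event that the other points of the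
process avoid the translate of `D` to the point `(i, j)`: summing over `j` gives the sibling factor,
and the other clusters contribute the void probability of the whole process. -/
lemma tsum_lintegral_reference_point [IsProbabilityMeasure P]
    (h : IsThomasClusterProcess P lam m σ X N Y) {A : Set Plane} (hA : MeasurableSet A)
    {D : Set Plane} (hD : MeasurableSet D) :
    ∑' i, ∑' j, ∫⁻ ω, A.indicator 1 (X i ω) *
      ∫⁻ y, siblingTerm m j (avoidProb σ D (-y)) *
        expNeg (∑' k, if k = i then 0 else hitExponent m σ D (X k ω - X i ω - y))
          ∂(offspringLaw σ) ∂P =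
      lam * volume A * voidProb lam m σ D * ∫⁻ y, siblingFactor m (avoidProb σ D (-y))
        ∂(offspringLaw σ) := by
  have hXm := h.parents.measurable
  have hf := measurable_hitExponent m σ hD
  have hc := measurable_avoidProb σ hD
  have hAm : Measurable (A.indicator (1 : Plane → ℝ≥0∞)) := measurable_one.indicator hA
  have hJ (g : Plane → ℝ≥0∞) (hg : Measurable g) : ∫⁻ y, g y ∂(offspringLaw σ) =
      ∫⁻ y, ENNReal.ofReal (offspringDensity σ y) * g y := by
    rw [offspringLaw, lintegral_withDensity_eq_lintegral_mul _ (by fun_prop) hg]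
    rfl
  have hmE (i : ℕ) : Measurable fun p : Ω × Plane => expNeg (∑' k,
      if k = i then 0 else hitExponent m σ D (X k p.1 - X i p.1 - p.2)) := by
    refine measurable_expNeg.comp (Measurable.tsum fun k => ?_)
    split_ifs
    · exact measurable_const
    · exact hf.comp ((((hXm k).comp measurable_fst).sub ((hXm i).comp measurable_fst)).sub
        measurable_snd)
  have hmJ (i j : ℕ) : Measurable fun p : Ω × Plane => siblingTerm m j (avoidProb σ D (-p.2)) *
      expNeg (∑' k, if k = i then 0 else hitExponent m σ D (X k p.1 - X i p.1 - p.2)) :=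
    Measurable.mul (by fun_prop) (hmE i)
  have hi (i : ℕ) : ∑' j, ∫⁻ ω, A.indicator 1 (X i ω) *
      ∫⁻ y, siblingTerm m j (avoidProb σ D (-y)) *
        expNeg (∑' k, if k = i then 0 else hitExponent m σ D (X k ω - X i ω - y))
          ∂(offspringLaw σ) ∂P =
      ∫⁻ ω, A.indicator 1 (X i ω) * (∫⁻ y, (ENNReal.ofReal (offspringDensity σ y) *
        siblingFactor m (avoidProb σ D (-y))) *
        expNeg (∑' k, if k = i then 0 else hitExponent m σ D (X k ω - X i ω - y))) ∂P := by
    have hm1 (j : ℕ) : AEMeasurable (fun ω => A.indicator 1 (X i ω) *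
        ∫⁻ y, siblingTerm m j (avoidProb σ D (-y)) *
        expNeg (∑' k, if k = i then 0 else hitExponent m σ D (X k ω - X i ω - y))
          ∂(offspringLaw σ)) P :=
      ((hAm.comp (hXm i)).mul
        (Measurable.lintegral_prod_right' (ν := offspringLaw σ) (hmJ i j))).aemeasurable
    rw [← lintegral_tsum hm1]
    refine lintegral_congr fun ω => ?_
    have hmω (j : ℕ) : AEMeasurable (fun y => siblingTerm m j (avoidProb σ D (-y)) *
        expNeg (∑' k, if k = i then 0 else hitExponent m σ D (X k ω - X i ω - y)))
        (offspringLaw σ) := ((hmJ i j).comp measurable_prodMk_left).aemeasurable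
    have hmω' : Measurable fun y => expNeg (∑' k,
        if k = i then 0 else hitExponent m σ D (X k ω - X i ω - y)) := by
      refine measurable_expNeg.comp (Measurable.tsum fun k => ?_)
      split_ifs <;> fun_prop
    rw [ENNReal.tsum_mul_left, ← lintegral_tsum hmω]
    simp only [ENNReal.tsum_mul_right, tsum_siblingTerm]
    congr 1
    refine (hJ _ (Measurable.mul (by fun_prop) hmω')).trans ?_
    simp only [Pi.mul_apply, mul_assoc]
  rw [tsum_congr hi, mecke_displaced h.parents hf (hitExponent_ne_top m σ D) (by fun_prop) hA,
    hJ _ (by fun_prop), voidProb]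

/-- The mean number `lam * area A` of parents in the window cancels, so the probability that the
reference point has no other point within distance `r` does not depend on `A`. -/
lemma refPointProb_nearest [IsProbabilityMeasure P] (hlam : 0 < lam)
    (h : IsThomasClusterProcess P lam m σ X N Y) {A : Set Plane} (hA : MeasurableSet A)
    (hA0 : volume A ≠ 0) (hA1 : volume A ≠ ∞) {r : ℝ} (hr : 0 ≤ r) :
    refPointProb P X N Y A
      (fun ω z => (clusterProcess X N Y ω ∩ Metric.closedBall z r).encard = 1) =
      voidProb lam m σ (Metric.closedBall 0 r \ {0}) *
        (∫⁻ y, siblingFactor m (avoidProb σ (Metric.closedBall 0 r \ {0}) (-y))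
          ∂(offspringLaw σ)) / (1 - expNeg m) := by
  classical
  have hD : MeasurableSet (Metric.closedBall (0 : Plane) r \ {0}) :=
    Metric.isClosed_closedBall.measurableSet.diff (measurableSet_singleton 0)
  set D := Metric.closedBall (0 : Plane) r \ {0} with hDdef
  have hAm : Measurable (A.indicator (1 : Plane → ℝ≥0∞)) := measurable_one.indicator hA
  have hm (i j : ℕ) : Measurable fun ω => A.indicator (1 : Plane → ℝ≥0∞) (X i ω) *
      ((if j < N i ω then (N i ω : ℝ≥0∞)⁻¹ else 0) *
        (if ∀ k l, (k, l) ≠ (i, j) → l < N k ω →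
          X k ω + Y k l ω - (X i ω + Y i j ω) ∉ D then 1 else 0)) := by
    have hX : Measurable fun ω i => X i ω := measurable_pi_lambda _ h.parents.measurable
    have hS := measurableSet_siblings_avoid hD i j (fun _ => True)
    simp only [true_implies] at hS
    have hW : Measurable fun n : ℕ => if j < n then (n : ℝ≥0∞)⁻¹ else 0 := .of_discrete
    exact (hAm.comp (h.parents.measurable i)).mul ((hW.comp (h.measurable_size i)).mul
      (Measurable.ite ((hX.prodMk (measurable_size_disp h)) hS) measurable_const measurable_const))
  have hnum (ω : Ω) : (∑' i : ℕ, if X i ω ∈ A ∧ N i ω ≠ 0 then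
      (∑ j ∈ Finset.range (N i ω), if (clusterProcess X N Y ω ∩
        Metric.closedBall (X i ω + Y i j ω) r).encard = 1 then (1 : ℝ≥0∞) else 0)
        / (N i ω : ℝ≥0∞) else 0) =
      ∑' i, ∑' j, A.indicator (1 : Plane → ℝ≥0∞) (X i ω) *
      ((if j < N i ω then (N i ω : ℝ≥0∞)⁻¹ else 0) *
        (if ∀ k l, (k, l) ≠ (i, j) → l < N k ω →
          X k ω + Y k l ω - (X i ω + Y i j ω) ∉ D then 1 else 0)) := by
    refine tsum_congr fun i => ?_
    rw [ENNReal.tsum_mul_left]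
    by_cases hx : X i ω ∈ A
    · rw [indicator_of_mem hx, Pi.one_apply, one_mul,
        tsum_eq_sum (s := Finset.range (N i ω)) fun j hj => by
          rw [if_neg (by simpa using hj), zero_mul]]
      by_cases hn : N i ω = 0
      · simp [hn]
      · rw [if_pos ⟨hx, hn⟩, ENNReal.div_eq_inv_mul, Finset.mul_sum]
        refine Finset.sum_congr rfl fun j hj => ?_
        have hj := Finset.mem_range.1 hj
        rw [if_pos hj]
        congr 1
        simp only [encard_inter_closedBall_eq_one_iff hr hj, hDdef]
    · simp [hx]
  have hnum2 : ∫⁻ ω, (∑' i : ℕ, if X i ω ∈ A ∧ N i ω ≠ 0 then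
      (∑ j ∈ Finset.range (N i ω), if (clusterProcess X N Y ω ∩
        Metric.closedBall (X i ω + Y i j ω) r).encard = 1 then (1 : ℝ≥0∞) else 0)
        / (N i ω : ℝ≥0∞) else 0) ∂P = lam * volume A * voidProb lam m σ D *
          ∫⁻ y, siblingFactor m (avoidProb σ D (-y)) ∂(offspringLaw σ) := by
    simp only [hnum]
    rw [lintegral_tsum fun i => (Measurable.tsum fun j => hm i j).aemeasurable]
    simp only [lintegral_tsum fun j => (hm _ j).aemeasurable,
      lintegral_reference_point h hA hD]
    exact tsum_lintegral_reference_point h hA hD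
  have hV0 : lam * volume A ≠ 0 := mul_ne_zero (by simpa using hlam.ne') hA0
  have hV1 : lam * volume A ≠ ∞ := ENNReal.mul_ne_top ENNReal.coe_ne_top hA1
  rw [refPointProb, meanNonemptyClusters_eq h hA hA1, mul_assoc _ (voidProb _ _ _ _) _] at *
  rw [← ENNReal.mul_div_mul_left _ (1 - expNeg m) hV0 hV1, ← hnum2]
  congr!

end NearestNeighbor

/-! ### The Rice distribution and the Marcum `Q`-function -/

section Bessel

lemma integral_cos_pow_odd_neg_pi_pi (k : ℕ) :
    ∫ θ in (-Real.pi)..Real.pi, Real.cos θ ^ (2 * k + 1) = 0 := by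
  induction k with
  | zero => simp
  | succ k ih => rw [show 2 * (k + 1) + 1 = 2 * k + 1 + 2 by ring, integral_cos_pow, ih]; simp

lemma integral_cos_pow_even_neg_pi_pi (k : ℕ) :
    ∫ θ in (-Real.pi)..Real.pi, Real.cos θ ^ (2 * k) =
      2 * Real.pi * (2 * k).factorial / (4 ^ k * (k.factorial : ℝ) ^ 2) := by
  induction k with
  | zero => simp; ring
  | succ k ih =>
    rw [show 2 * (k + 1) = 2 * k + 2 by ring, integral_cos_pow, ih]
    push_cast [Nat.factorial_succ]
    simp only [Real.sin_pi, Real.sin_neg, mul_zero, neg_zero, sub_zero, zero_div, zero_add]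
    field_simp
    ring

lemma hasSum_integral_exp_mul_cos (x : ℝ) :
    HasSum (fun n : ℕ => ∫ θ in (-Real.pi)..Real.pi, (x * Real.cos θ) ^ n / n.factorial)
      (∫ θ in (-Real.pi)..Real.pi, Real.exp (x * Real.cos θ)) := by
  refine intervalIntegral.hasSum_integral_of_dominated_convergence
    (fun n _ => |x| ^ n / n.factorial) (fun n => ?_) (fun n => ?_) ?_ ?_ ?_
  · have h : Continuous fun θ => (x * Real.cos θ) ^ n / n.factorial := by fun_prop
    exact h.aestronglyMeasurable
  · refine .of_forall fun θ _ => ?_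
    rw [norm_div, norm_pow, Real.norm_eq_abs, abs_mul, Real.norm_natCast]
    gcongr
    exact mul_le_of_le_one_right (abs_nonneg x) (Real.abs_cos_le_one θ)
  · exact .of_forall fun _ _ => Real.summable_pow_div_factorial |x|
  · simp
  · refine .of_forall fun θ _ => ?_
    rw [Real.exp_eq_exp_ℝ]
    exact NormedSpace.expSeries_div_hasSum_exp (x * Real.cos θ)

/-- The integral representation of the modified Bessel function of order zero. -/
lemma integral_exp_mul_cos (x : ℝ) :
    ∫ θ in (-Real.pi)..Real.pi, Real.exp (x * Real.cos θ) = 2 * Real.pi * besselIZero x := by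
  have h := hasSum_integral_exp_mul_cos x
  have hinj : Function.Injective fun k : ℕ => 2 * k := fun a b hab => by simpa using hab
  rw [← hinj.hasSum_iff] at h
  · rw [← h.tsum_eq, besselIZero, ← tsum_mul_left]
    refine tsum_congr fun k => ?_
    simp only [Function.comp_apply, mul_pow, intervalIntegral.integral_div,
      intervalIntegral.integral_const_mul, integral_cos_pow_even_neg_pi_pi]
    rw [div_pow, pow_mul (2 : ℝ)]
    norm_num
    field_simp
  · intro n hn
    obtain ⟨k, rfl⟩ : Odd n := by
      rw [← Nat.not_even_iff_odd, even_iff_two_dvd]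
      rintro ⟨k, rfl⟩
      exact hn ⟨k, rfl⟩
    simp only [mul_pow, intervalIntegral.integral_div,
      intervalIntegral.integral_const_mul, integral_cos_pow_odd_neg_pi_pi, mul_zero, zero_div]

lemma continuous_besselIZero : Continuous besselIZero := by
  have h : besselIZero = fun x => (2 * Real.pi)⁻¹ *
      ∫ θ in (-Real.pi)..Real.pi, Real.exp (x * Real.cos θ) := by
    ext x
    rw [integral_exp_mul_cos]
    field_simp
  rw [h]
  exact continuous_const.mul
    (intervalIntegral.continuous_parametric_intervalIntegral_of_continuous' (by fun_prop) _ _)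

lemma besselIZero_nonneg (x : ℝ) : 0 ≤ besselIZero x :=
  tsum_nonneg fun k => by rw [pow_mul]; positivity

end Bessel

section Rice

lemma exists_linearIsometryEquiv_complex (w : Plane) :
    ∃ e : Plane ≃ₗᵢ[ℝ] ℂ, e w = (‖w‖ : ℂ) := by
  let e₀ : Plane ≃ₗᵢ[ℝ] ℂ := Complex.orthonormalBasisOneI.repr.symm
  refine ⟨e₀.trans (rotation (Circle.exp (-Complex.arg (e₀ w)))), ?_⟩
  rw [LinearIsometryEquiv.trans_apply, rotation_apply, Circle.coe_exp, ← e₀.norm_map w]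
  have h := Complex.norm_mul_exp_arg_mul_I (e₀ w)
  calc Complex.exp (((-Complex.arg (e₀ w) : ℝ) : ℂ) * Complex.I) * e₀ w
      = Complex.exp (((-Complex.arg (e₀ w) : ℝ) : ℂ) * Complex.I) *
        (‖e₀ w‖ * Complex.exp (Complex.arg (e₀ w) * Complex.I)) := by rw [h]
    _ = ‖e₀ w‖ := by
      rw [mul_left_comm, ← Complex.exp_add]
      simp

lemma lintegral_complex_polar {g : ℂ → ℝ≥0∞} (hg : Measurable g) :
    ∫⁻ z, g z = ∫⁻ ρ in Ioi (0 : ℝ), ∫⁻ θ in Ioo (-Real.pi) Real.pi,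
      ENNReal.ofReal ρ * g (Complex.polarCoord.symm (ρ, θ)) := by
  rw [← Complex.lintegral_comp_polarCoord_symm, polarCoord_target,
    Measure.volume_eq_prod, ← Measure.prod_restrict, lintegral_prod]
  · rfl
  · refine Measurable.aemeasurable ?_
    have : Measurable fun p : ℝ × ℝ => Complex.polarCoord.symm p := by
      simp only [Complex.polarCoord_symm_apply]
      fun_prop
    exact Measurable.mul (by fun_prop) (hg.comp this)

/-- The Rice density at `ρ`: the density of a normal vector centred at distance `a` from the
origin, integrated over the circle of radius `ρ`. -/
lemma lintegral_circle_offspring {σ : ℝ} (hσ : 0 < σ) (a : ℝ) {ρ : ℝ} (hρ : 0 < ρ) :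
    ∫⁻ θ in Ioo (-Real.pi) Real.pi, ENNReal.ofReal ρ * ENNReal.ofReal (1 / (2 * Real.pi * σ ^ 2) *
      Real.exp (-‖Complex.polarCoord.symm (ρ, θ) - (a : ℂ)‖ ^ 2 / (2 * σ ^ 2))) =
    ENNReal.ofReal (ρ / σ ^ 2 * Real.exp (-(ρ ^ 2 + a ^ 2) / (2 * σ ^ 2)) *
      besselIZero (a * ρ / σ ^ 2)) := by
  have hpi := Real.pi_pos
  have hnorm (θ : ℝ) : ‖Complex.polarCoord.symm (ρ, θ) - (a : ℂ)‖ ^ 2 =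
      ρ ^ 2 + a ^ 2 - 2 * a * ρ * Real.cos θ := by
    rw [Complex.polarCoord_symm_apply, Complex.sq_norm, Complex.normSq_apply]
    simp
    simp only [Complex.cos_ofReal_re, Complex.sin_ofReal_re]
    linear_combination ρ ^ 2 * Real.sin_sq_add_cos_sq θ
  set C := ρ / (2 * Real.pi * σ ^ 2) * Real.exp (-(ρ ^ 2 + a ^ 2) / (2 * σ ^ 2)) with hC
  have hint (θ : ℝ) : ENNReal.ofReal ρ * ENNReal.ofReal (1 / (2 * Real.pi * σ ^ 2) *
      Real.exp (-‖Complex.polarCoord.symm (ρ, θ) - (a : ℂ)‖ ^ 2 / (2 * σ ^ 2))) =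
      ENNReal.ofReal (C * Real.exp (a * ρ / σ ^ 2 * Real.cos θ)) := by
    rw [← ENNReal.ofReal_mul hρ.le, hnorm, hC]
    congr 1
    rw [show -(ρ ^ 2 + a ^ 2 - 2 * a * ρ * Real.cos θ) / (2 * σ ^ 2) =
      -(ρ ^ 2 + a ^ 2) / (2 * σ ^ 2) + a * ρ / σ ^ 2 * Real.cos θ by field_simp; ring, Real.exp_add]
    ring
  have hcont : Continuous fun θ => C * Real.exp (a * ρ / σ ^ 2 * Real.cos θ) := by fun_prop
  simp only [hint]
  rw [← ofReal_integral_eq_lintegral_ofReal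
    ((hcont.integrableOn_Icc (a := -Real.pi) (b := Real.pi)).mono_set Ioo_subset_Icc_self)
    (.of_forall fun θ => by positivity), ← integral_Ioc_eq_integral_Ioo,
    ← intervalIntegral.integral_of_le (by linarith), intervalIntegral.integral_const_mul,
    integral_exp_mul_cos, hC]
  congr 1
  field_simp

/-- The avoidance probability of a disc as a Rice tail. The isometry to `ℂ` puts the parent on the
positive real axis. -/
lemma avoidProb_ball {σ : ℝ} (hσ : 0 < σ) {r : ℝ} (hr : 0 ≤ r) (w : Plane) :
    avoidProb σ (Metric.closedBall 0 r) w = ∫⁻ ρ in Ioi r,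
      ENNReal.ofReal (ρ / σ ^ 2 * Real.exp (-(ρ ^ 2 + ‖w‖ ^ 2) / (2 * σ ^ 2)) *
        besselIZero (‖w‖ * ρ / σ ^ 2)) := by
  obtain ⟨e, he⟩ := exists_linearIsometryEquiv_complex w
  have hS : MeasurableSet {z : Plane | z ∉ Metric.closedBall (0 : Plane) r} :=
    Metric.isClosed_closedBall.measurableSet.compl
  have hwS : MeasurableSet {u : Plane | w + u ∉ Metric.closedBall (0 : Plane) r} :=
    (measurable_const_add w) hS
  have hS' : MeasurableSet {z : ℂ | r < ‖z‖} := measurableSet_lt measurable_const measurable_norm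
  let g : ℂ → ℝ≥0∞ := fun z => ENNReal.ofReal (1 / (2 * Real.pi * σ ^ 2) *
      Real.exp (-‖z - (‖w‖ : ℂ)‖ ^ 2 / (2 * σ ^ 2))) * {z : ℂ | r < ‖z‖}.indicator 1 z
  have hg : Measurable g := Measurable.mul (by fun_prop) (measurable_one.indicator hS')
  have h1 : avoidProb σ (Metric.closedBall 0 r) w = ∫⁻ z, g z := by
    rw [← (e.measurePreserving).lintegral_comp hg, avoidProb, offspringLaw,
      withDensity_apply _ hwS, ← lintegral_indicator hwS, ← lintegral_sub_right_eq_self _ w]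
    refine lintegral_congr fun z => ?_
    have h2 : ‖e z - (‖w‖ : ℂ)‖ = ‖z - w‖ := by rw [← he, ← map_sub, e.norm_map]
    simp only [g, h2, indicator_apply, mem_ofPred_eq, e.norm_map, add_sub_cancel,
      mem_closedBall_zero_iff, not_le, offspringDensity]
    split_ifs <;> simp
  have h3 (ρ : ℝ) (hρ : ρ ∈ Ioi (0 : ℝ)) : ∫⁻ θ in Ioo (-Real.pi) Real.pi,
      ENNReal.ofReal ρ * g (Complex.polarCoord.symm (ρ, θ)) =
      (Ioi r).indicator (fun ρ => ENNReal.ofReal (ρ / σ ^ 2 *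
        Real.exp (-(ρ ^ 2 + ‖w‖ ^ 2) / (2 * σ ^ 2)) * besselIZero (‖w‖ * ρ / σ ^ 2))) ρ := by
    have hn (θ : ℝ) : ‖Complex.polarCoord.symm (ρ, θ)‖ = ρ := by
      rw [Complex.norm_polarCoord_symm, abs_of_pos hρ]
    by_cases hρr : r < ρ
    · rw [indicator_of_mem (mem_Ioi.2 hρr), ← lintegral_circle_offspring hσ ‖w‖ hρ]
      simp only [g, indicator_apply, mem_ofPred_eq, hn, hρr, if_true, Pi.one_apply, mul_one]
    · rw [indicator_of_notMem (by simpa using hρr)]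
      simp only [g, indicator_apply, mem_ofPred_eq, hn, hρr, if_false, mul_zero,
        lintegral_zero]
  rw [h1, lintegral_complex_polar hg, setLIntegral_congr_fun measurableSet_Ioi h3,
    setLIntegral_indicator measurableSet_Ioi, Ioi_inter_Ioi, sup_eq_left.2 hr]

lemma integral_rice_eq_marcumQ {σ : ℝ} (hσ : 0 < σ) (a r : ℝ) :
    ∫ ρ in Ioi r, ρ / σ ^ 2 * Real.exp (-(ρ ^ 2 + a ^ 2) / (2 * σ ^ 2)) *
        besselIZero (a * ρ / σ ^ 2) = marcumQ (a / σ) (r / σ) := by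
  have h := integral_comp_mul_left_Ioi (fun ρ => ρ / σ ^ 2 *
    Real.exp (-(ρ ^ 2 + a ^ 2) / (2 * σ ^ 2)) * besselIZero (a * ρ / σ ^ 2)) (r / σ) hσ
  rw [mul_div_cancel₀ _ hσ.ne', smul_eq_mul] at h
  rw [← mul_right_inj' (inv_ne_zero hσ.ne'), ← h, marcumQ, ← integral_const_mul]
  refine integral_congr_ae (.of_forall fun y => ?_)
  simp only
  rw [show -((σ * y) ^ 2 + a ^ 2) / (2 * σ ^ 2) = -(y ^ 2 + (a / σ) ^ 2) / 2 by
      field_simp, show a * (σ * y) / σ ^ 2 = a / σ * y by field_simp,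
    show σ * y / σ ^ 2 = σ⁻¹ * y by field_simp]
  ring

/-- Removing the centre of the disc does not change the avoidance probability, as the displacements
have a density. -/
lemma avoidProb_diff_singleton (σ : ℝ) (D : Set Plane) (x w : Plane) :
    avoidProb σ (D \ {x}) w = avoidProb σ D w := by
  have hx : offspringLaw σ {x - w} = 0 :=
    withDensity_absolutelyContinuous _ _ (measure_singleton _)
  refine le_antisymm ?_ (measure_mono fun u hu h => hu h.1)
  refine (measure_mono (t := {u | w + u ∉ D} ∪ {x - w}) fun u hu => ?_).trans
    ((measure_union_le _ _).trans_eq (by rw [hx, add_zero]; rfl))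
  by_cases hD : w + u ∈ D
  · right
    by_contra hne
    exact hu ⟨hD, fun h => hne (eq_sub_of_add_eq' h)⟩
  · exact Or.inl hD

/-- The Marcum `Q`-function is the tail of the distance of a cluster point from the origin. -/
theorem avoidProb_eq_marcumQ {σ : ℝ} (hσ : 0 < σ) [IsProbabilityMeasure (offspringLaw σ)]
    {r : ℝ} (hr : 0 ≤ r) (w : Plane) :
    avoidProb σ (Metric.closedBall 0 r) w = ENNReal.ofReal (marcumQ (‖w‖ / σ) (r / σ)) := by
  have hfin : avoidProb σ (Metric.closedBall 0 r) w ≠ ∞ := measure_ne_top _ _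
  have hcont : Continuous fun ρ => ρ / σ ^ 2 * Real.exp (-(ρ ^ 2 + ‖w‖ ^ 2) / (2 * σ ^ 2)) *
      besselIZero (‖w‖ * ρ / σ ^ 2) := by
    have := continuous_besselIZero
    fun_prop
  rw [← integral_rice_eq_marcumQ hσ, integral_eq_lintegral_of_nonneg_ae ?_
    hcont.aestronglyMeasurable, ← avoidProb_ball hσ hr, ENNReal.ofReal_toReal hfin]
  filter_upwards [ae_restrict_mem measurableSet_Ioi] with ρ hρ
  have : 0 ≤ ρ := hr.trans (le_of_lt hρ)
  exact mul_nonneg (by positivity) (besselIZero_nonneg _)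

/-- The normal law charges the complement of every disc. This keeps the Marcum `Q`-function in the
denominators away from zero. -/
lemma avoidProb_ball_ne_zero {σ : ℝ} (hσ : 0 < σ) (r : ℝ) (w : Plane) :
    avoidProb σ (Metric.closedBall 0 r) w ≠ 0 := by
  have hopen : IsOpen {u : Plane | w + u ∉ Metric.closedBall (0 : Plane) r} :=
    Metric.isClosed_closedBall.isOpen_compl.preimage (by fun_prop)
  have hpos (y : Plane) : 0 < offspringDensity σ y := by
    unfold offspringDensity; positivity
  have hne : {u : Plane | w + u ∉ Metric.closedBall (0 : Plane) r}.Nonempty := by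
    obtain ⟨z, hz⟩ := NormedSpace.exists_lt_norm ℝ Plane r
    exact ⟨z - w, by simpa using hz⟩
  rw [avoidProb, offspringLaw, withDensity_apply _ hopen.measurableSet]
  intro h0
  rw [lintegral_eq_zero_iff (by fun_prop)] at h0
  have : volume {u : Plane | w + u ∉ Metric.closedBall (0 : Plane) r} = 0 := by
    rw [← Measure.restrict_eq_zero, ← ae_eq_bot]
    refine Filter.eventually_false_iff_eq_bot.1 (h0.mono fun y hy => ?_)
    exact (ENNReal.ofReal_pos.2 (hpos y)).ne' hy
  exact hopen.measure_ne_zero _ hne this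

end Rice

/-! ### Radial integrals and the distribution functions -/

/-- Polar coordinates for nonnegative radial functions with finite integral. -/
lemma integrableOn_and_lintegral_radial {H : ℝ → ℝ} (hm : Measurable fun x : Plane => H ‖x‖)
    (h0 : ∀ x : Plane, 0 ≤ H ‖x‖) (hfin : ∫⁻ x : Plane, ENNReal.ofReal (H ‖x‖) ≠ ∞) :
    IntegrableOn (fun v => H v * v) (Ioi 0) ∧
      ∫⁻ x : Plane, ENNReal.ofReal (H ‖x‖) =
        ENNReal.ofReal (2 * Real.pi * ∫ v in Ioi (0 : ℝ), H v * v) := by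
  have hint : Integrable fun x : Plane => H ‖x‖ :=
    (lintegral_ofReal_ne_top_iff_integrable hm.aestronglyMeasurable (.of_forall h0)).1 hfin
  have h1 := (integrable_fun_norm_addHaar (volume : Measure Plane) (f := H)).1 hint
  have h2 := integral_fun_norm_addHaar (volume : Measure Plane) H
  simp only [finrank_euclideanSpace, Fintype.card_fin, smul_eq_mul, Nat.add_one_sub_one, pow_one,
    measureReal_def, EuclideanSpace.volume_ball_fin_two] at h1 h2
  refine ⟨by simpa only [mul_comm] using h1, ?_⟩
  rw [← ofReal_integral_eq_lintegral_ofReal hint (.of_forall h0), h2]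
  congr 1
  simp [Real.pi_pos.le, mul_assoc, mul_comm _ (H _)]

section Formulas

variable {σ : ℝ} [IsProbabilityMeasure (offspringLaw σ)]

lemma marcumQ_norm (hσ : 0 < σ) {r : ℝ} (hr : 0 ≤ r) :
    (∀ x : Plane, 0 < marcumQ (‖x‖ / σ) (r / σ) ∧ marcumQ (‖x‖ / σ) (r / σ) ≤ 1) ∧
      Measurable fun x : Plane => marcumQ (‖x‖ / σ) (r / σ) := by
  have h1 (x : Plane) : 0 < marcumQ (‖x‖ / σ) (r / σ) := by
    have := avoidProb_ball_ne_zero hσ r x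
    rw [avoidProb_eq_marcumQ hσ hr] at this
    simpa using this
  refine ⟨fun x => ⟨h1 x, ?_⟩, ?_⟩
  · rw [← ENNReal.ofReal_le_one, ← avoidProb_eq_marcumQ hσ hr]
    exact prob_le_one
  · have := (measurable_avoidProb σ
      (Metric.isClosed_closedBall (x := (0 : Plane)) (ε := r)).measurableSet).ennreal_toReal
    convert this using 2 with x
    rw [avoidProb_eq_marcumQ hσ hr, ENNReal.toReal_ofReal (h1 x).le]

lemma hitExponent_eq (hσ : 0 < σ) {r : ℝ} (hr : 0 ≤ r) (m : ℝ≥0) (x : Plane) :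
    hitExponent m σ (Metric.closedBall 0 r) x =
      ENNReal.ofReal (m * (1 - marcumQ (‖x‖ / σ) (r / σ))) := by
  rw [hitExponent, avoidProb_eq_marcumQ hσ hr, ENNReal.ofReal_mul m.coe_nonneg,
    ENNReal.ofReal_sub _ ((marcumQ_norm hσ hr).1 x).1.le]
  simp

/-- The mean number of displaced points in a disc is its area, by translation invariance. -/
lemma lintegral_hitExponent_ne_top (m : ℝ≥0) (r : ℝ) :
    ∫⁻ x, hitExponent m σ (Metric.closedBall 0 r) x ≠ ∞ := by
  have hD : MeasurableSet (Metric.closedBall (0 : Plane) r) :=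
    Metric.isClosed_closedBall.measurableSet
  have hind : Measurable ((Metric.closedBall (0 : Plane) r).indicator (1 : Plane → ℝ≥0∞)) :=
    measurable_one.indicator hD
  have h1 (x : Plane) : 1 - avoidProb σ (Metric.closedBall 0 r) x =
      ∫⁻ u, (Metric.closedBall (0 : Plane) r).indicator 1 (x + u) ∂(offspringLaw σ) := by
    have hS : MeasurableSet {u : Plane | x + u ∈ Metric.closedBall (0 : Plane) r} :=
      (measurable_const_add x) hD
    have := prob_compl_eq_one_sub (μ := offspringLaw σ) hS.compl
    rw [compl_compl] at this
    rw [avoidProb]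
    exact this.symm.trans (lintegral_indicator_one hS).symm
  simp only [hitExponent, h1]
  rw [lintegral_const_mul' _ _ ENNReal.coe_ne_top, lintegral_lintegral_swap
    (f := fun x u => (Metric.closedBall (0 : Plane) r).indicator 1 (x + u))
    (hind.comp (measurable_fst.add measurable_snd)).aemeasurable]
  simp only [lintegral_add_right_eq_self
    ((Metric.closedBall (0 : Plane) r).indicator (1 : Plane → ℝ≥0∞)),
    lintegral_indicator_one hD, lintegral_const, measure_univ, mul_one]
  exact ENNReal.mul_ne_top ENNReal.coe_ne_top measure_closedBall_lt_top.ne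

/-- The void probability of a disc in terms of the Marcum `Q`-function; the integrand is bounded by
`hitExponent`, which has finite integral. -/
lemma voidProb_eq (hσ : 0 < σ) (lam m : ℝ≥0) {r : ℝ} (hr : 0 ≤ r) :
    IntegrableOn (fun v : ℝ =>
      (1 - Real.exp (-(m : ℝ) * (1 - marcumQ (v / σ) (r / σ)))) * v) (Ioi 0) ∧
    voidProb lam m σ (Metric.closedBall 0 r) = ENNReal.ofReal (Real.exp (-2 * Real.pi * (lam : ℝ) *
        ∫ v in Ioi (0 : ℝ),
          (1 - Real.exp (-(m : ℝ) * (1 - marcumQ (v / σ) (r / σ)))) * v)) := by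
  obtain ⟨hq, hqm⟩ := marcumQ_norm hσ hr
  have hpos (x : Plane) : 0 ≤ (m : ℝ) * (1 - marcumQ (‖x‖ / σ) (r / σ)) :=
    mul_nonneg m.coe_nonneg (sub_nonneg.2 (hq x).2)
  have h1 (x : Plane) : 1 - expNeg (hitExponent m σ (Metric.closedBall 0 r) x) =
      ENNReal.ofReal (1 - Real.exp (-(m : ℝ) * (1 - marcumQ (‖x‖ / σ) (r / σ)))) := by
    rw [hitExponent_eq hσ hr, one_sub_expNeg_ofReal (hpos x), neg_mul]
  have h2 := integrableOn_and_lintegral_radial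
    (H := fun v => 1 - Real.exp (-(m : ℝ) * (1 - marcumQ (v / σ) (r / σ)))) (by fun_prop)
    (fun x => by simpa using hpos x) (by
      simp only [← h1]
      exact ne_top_of_le_ne_top (lintegral_hitExponent_ne_top (σ := σ) m r)
        (lintegral_mono fun x => one_sub_expNeg_le _))
  refine ⟨h2.1, ?_⟩
  have hI : 0 ≤ ∫ v in Ioi (0 : ℝ),
      (1 - Real.exp (-(m : ℝ) * (1 - marcumQ (v / σ) (r / σ)))) * v := by
    refine setIntegral_nonneg measurableSet_Ioi fun v hv => mul_nonneg ?_ (le_of_lt hv)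
    obtain ⟨x, hx⟩ := exists_norm_eq Plane (le_of_lt hv)
    rw [← hx]
    simpa using hpos x
  rw [voidProb]
  simp only [h1, h2.2]
  rw [← ENNReal.ofReal_coe_nnreal, ← ENNReal.ofReal_mul lam.coe_nonneg,
    expNeg_ofReal (by positivity)]
  congr 2
  ring

lemma siblingFactor_marcumQ (hσ : 0 < σ) (m : ℝ≥0) {r : ℝ} (hr : 0 ≤ r) (x : Plane) :
    siblingFactor m (avoidProb σ (Metric.closedBall 0 r) x) =
      ENNReal.ofReal ((Real.exp (m * marcumQ (‖x‖ / σ) (r / σ)) - 1) /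
        marcumQ (‖x‖ / σ) (r / σ) * Real.exp (-m)) := by
  have hq := (marcumQ_norm hσ hr).1 x
  have h1 := hitExponent_eq hσ hr m x
  rw [hitExponent] at h1
  rw [siblingFactor_eq m (avoidProb_le_one σ _ x) (avoidProb_ball_ne_zero hσ r x), h1, expNeg_coe,
    expNeg_ofReal (mul_nonneg m.coe_nonneg (sub_nonneg.2 hq.2)), avoidProb_eq_marcumQ hσ hr,
    ← ENNReal.ofReal_sub _ (Real.exp_nonneg _), ← ENNReal.ofReal_div_of_pos hq.1]
  congr 1
  rw [show -((m : ℝ) * (1 - marcumQ (‖x‖ / σ) (r / σ))) =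
    m * marcumQ (‖x‖ / σ) (r / σ) + -m by ring, Real.exp_add]
  ring

/-- The conditional mean of the sibling factor given a nonempty cluster, as an integral against the
Rayleigh density of the distance between the reference point and its parent. -/
lemma lintegral_siblingFactor_eq (hσ : 0 < σ) {m : ℝ≥0} (hm : 0 < m) {r : ℝ} (hr : 0 ≤ r) :
    IntegrableOn (fun v₀ : ℝ =>
      (Real.exp ((m : ℝ) * marcumQ (v₀ / σ) (r / σ)) - 1) / marcumQ (v₀ / σ) (r / σ)
        * (Real.exp (-(m : ℝ)) / (1 - Real.exp (-(m : ℝ)))) * rayleighDensity σ v₀) (Ioi 0) ∧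
    (∫⁻ y, siblingFactor m (avoidProb σ (Metric.closedBall 0 r) (-y)) ∂(offspringLaw σ)) /
      (1 - expNeg m) = ENNReal.ofReal (∫ v₀ in Ioi (0 : ℝ),
      (Real.exp ((m : ℝ) * marcumQ (v₀ / σ) (r / σ)) - 1) / marcumQ (v₀ / σ) (r / σ)
        * (Real.exp (-(m : ℝ)) / (1 - Real.exp (-(m : ℝ)))) * rayleighDensity σ v₀) := by
  obtain ⟨hq, hqm⟩ := marcumQ_norm hσ hr
  have hm' : (0 : ℝ) < 1 - Real.exp (-(m : ℝ)) := by
    have : (0 : ℝ) < m := hm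
    simpa using this
  have hE : 1 - expNeg m = ENNReal.ofReal (1 - Real.exp (-(m : ℝ))) := by
    rw [← ENNReal.ofReal_coe_nnreal, one_sub_expNeg_ofReal m.coe_nonneg]
  let H : ℝ → ℝ := fun v => (Real.exp ((m : ℝ) * marcumQ (v / σ) (r / σ)) - 1) /
    marcumQ (v / σ) (r / σ) * (Real.exp (-(m : ℝ)) / (1 - Real.exp (-(m : ℝ)))) *
    (1 / (2 * Real.pi * σ ^ 2) * Real.exp (-v ^ 2 / (2 * σ ^ 2)))
  have hK0 (x : Plane) : 0 ≤ (Real.exp (m * marcumQ (‖x‖ / σ) (r / σ)) - 1) /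
        marcumQ (‖x‖ / σ) (r / σ) := by
    refine div_nonneg (sub_nonneg.2 (Real.one_le_exp ?_)) (hq x).1.le
    exact mul_nonneg m.coe_nonneg (hq x).1.le
  have hH0 (x : Plane) : 0 ≤ H ‖x‖ :=
    mul_nonneg (mul_nonneg (hK0 x) (by positivity)) (by positivity)
  have hHm : Measurable fun x : Plane => H ‖x‖ := by
    simp only [H]
    fun_prop
  have hc := measurable_avoidProb σ
      (Metric.isClosed_closedBall (x := (0 : Plane)) (ε := r)).measurableSet
  have hL : (∫⁻ y, siblingFactor m (avoidProb σ (Metric.closedBall 0 r) (-y)) ∂(offspringLaw σ)) /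
      (1 - expNeg m) = ∫⁻ x : Plane, ENNReal.ofReal (H ‖x‖) := by
    rw [ENNReal.div_eq_inv_mul, hE, ← lintegral_const_mul _ (by fun_prop), offspringLaw,
      lintegral_withDensity_eq_lintegral_mul _ (by fun_prop) (by fun_prop)]
    refine lintegral_congr fun x => ?_
    rw [Pi.mul_apply, siblingFactor_marcumQ hσ m hr, norm_neg,
      ← ENNReal.ofReal_inv_of_pos hm', ← ENNReal.ofReal_mul (by positivity),
      ← ENNReal.ofReal_mul (by unfold offspringDensity; positivity), offspringDensity]
    congr 1
    simp only [H]
    field_simp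
  have hfin : ∫⁻ x : Plane, ENNReal.ofReal (H ‖x‖) ≠ ∞ := by
    rw [← hL]
    refine ENNReal.div_ne_top (ne_top_of_le_ne_top ENNReal.one_ne_top ?_)
      (by rw [hE]; simpa using hm')
    calc _ ≤ ∫⁻ y, 1 ∂(offspringLaw σ) :=
          lintegral_mono fun y => siblingFactor_le_one m (avoidProb_le_one σ _ _)
      _ = 1 := by simp
  obtain ⟨h1, h2⟩ := integrableOn_and_lintegral_radial hHm hH0 hfin
  have hpi := Real.pi_pos
  have h3 (v : ℝ) : (Real.exp ((m : ℝ) * marcumQ (v / σ) (r / σ)) - 1) / marcumQ (v / σ) (r / σ)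
        * (Real.exp (-(m : ℝ)) / (1 - Real.exp (-(m : ℝ)))) * rayleighDensity σ v =
        2 * Real.pi * (H v * v) := by
    simp only [H, rayleighDensity]
    field_simp
  simp only [h3]
  exact ⟨h1.const_mul _, by rw [hL, h2, integral_const_mul]⟩

end Formulas

lemma contactCDF_eq {Ω : Type*} [MeasurableSpace Ω] {P : Measure Ω} [IsProbabilityMeasure P]
    {lam m : ℝ≥0} {σ : ℝ} {X : ℕ → Ω → Plane} {N : ℕ → Ω → ℕ} {Y : ℕ → ℕ → Ω → Plane}
    (h : IsThomasClusterProcess P lam m σ X N Y) (r : ℝ) :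
    contactCDF P X N Y r = 1 - (voidProb lam m σ (Metric.closedBall 0 r)).toReal := by
  have hD : MeasurableSet (Metric.closedBall (0 : Plane) r) :=
    Metric.isClosed_closedBall.measurableSet
  have hS : MeasurableSet {ω | ∀ i j, j < N i ω → X i ω + Y i j ω ∉ Metric.closedBall 0 r} := by
    refine measurableSet_setOfPred.2 (Measurable.forall fun i => Measurable.forall fun j =>
      Measurable.imp ?_ (Measurable.not ?_))
    · exact measurableSet_setOfPred.1 (measurableSet_lt measurable_const (h.measurable_size i))
    · exact measurableSet_setOfPred.1
        (((h.parents.measurable i).add (h.measurable_disp i j)) hD)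
  rw [← measure_disjoint_clusterProcess h hD, ← measureReal_def, ← probReal_compl_eq_one_sub hS,
    contactCDF]
  congr 1
  ext ω
  rw [mem_ofPred_eq, encard_pos]
  simp only [mem_compl_iff, mem_ofPred_eq, not_forall, not_not]
  constructor
  · rintro ⟨z, hz, hzr⟩
    obtain ⟨i, j, hj, rfl⟩ := mem_iUnion.1 hz
    exact ⟨i, j, hj, hzr⟩
  · rintro ⟨i, j, hj, hzr⟩
    exact ⟨_, mem_iUnion.2 ⟨i, j, hj, rfl⟩, hzr⟩

theorem theorem3 {Ω : Type*} [MeasurableSpace Ω] (P : Measure Ω) [IsProbabilityMeasure P]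
    (lam m : ℝ≥0) (σ : ℝ) (hlam : 0 < lam) (hm : 0 < m) (hσ : 0 < σ)
    (X : ℕ → Ω → Plane) (N : ℕ → Ω → ℕ) (Y : ℕ → ℕ → Ω → Plane)
    (hΨ : IsThomasClusterProcess P lam m σ X N Y)
    (A : Set Plane) (hA : MeasurableSet A) (hA0 : volume A ≠ 0) (hA1 : volume A ≠ ∞)
    (r : ℝ) (hr : 0 ≤ r) :
    meanNonemptyClusters P X N A ≠ 0 ∧ meanNonemptyClusters P X N A ≠ ∞ ∧
    IntegrableOn (fun v : ℝ =>
      (1 - Real.exp (-(m : ℝ) * (1 - marcumQ (v / σ) (r / σ)))) * v) (Ioi 0) ∧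
    contactCDF P X N Y r =
      1 - Real.exp (-2 * Real.pi * (lam : ℝ) *
        ∫ v in Ioi (0 : ℝ),
          (1 - Real.exp (-(m : ℝ) * (1 - marcumQ (v / σ) (r / σ)))) * v) ∧
    IntegrableOn (fun v₀ : ℝ =>
      (Real.exp ((m : ℝ) * marcumQ (v₀ / σ) (r / σ)) - 1) / marcumQ (v₀ / σ) (r / σ)
        * (Real.exp (-(m : ℝ)) / (1 - Real.exp (-(m : ℝ)))) * rayleighDensity σ v₀) (Ioi 0) ∧
    nearestNeighborCDF P X N Y A r =
      1 - (1 - contactCDF P X N Y r) *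
        ∫ v₀ in Ioi (0 : ℝ),
          (Real.exp ((m : ℝ) * marcumQ (v₀ / σ) (r / σ)) - 1) / marcumQ (v₀ / σ) (r / σ)
            * (Real.exp (-(m : ℝ)) / (1 - Real.exp (-(m : ℝ)))) * rayleighDensity σ v₀ := by
  have hprob := isProbabilityMeasure_offspringLaw hΨ
  obtain ⟨hI1, hvoid⟩ := voidProb_eq hσ lam m hr
  obtain ⟨hI2, hpick⟩ := lintegral_siblingFactor_eq hσ hm hr
  have hE0 : 1 - expNeg m ≠ 0 := by
    rw [← ENNReal.ofReal_coe_nnreal, one_sub_expNeg_ofReal m.coe_nonneg]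
    simpa using hm
  have hV0 : lam * volume A ≠ 0 := mul_ne_zero (by simpa using hlam.ne') hA0
  have hcontact := contactCDF_eq hΨ r
  -- the punctured disc and the disc are avoided with the same probabilities
  have hav : avoidProb σ (Metric.closedBall 0 r \ {0}) = avoidProb σ (Metric.closedBall 0 r) :=
    funext fun w => avoidProb_diff_singleton σ _ 0 w
  have hv : voidProb lam m σ (Metric.closedBall 0 r \ {0}) =
      voidProb lam m σ (Metric.closedBall 0 r) := by
    unfold voidProb hitExponent
    rw [hav]
  have hint0 : 0 ≤ ∫ v₀ in Ioi (0 : ℝ),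
      (Real.exp ((m : ℝ) * marcumQ (v₀ / σ) (r / σ)) - 1) / marcumQ (v₀ / σ) (r / σ)
        * (Real.exp (-(m : ℝ)) / (1 - Real.exp (-(m : ℝ)))) * rayleighDensity σ v₀ := by
    refine setIntegral_nonneg measurableSet_Ioi fun v hv => ?_
    obtain ⟨x, hx⟩ := exists_norm_eq Plane (le_of_lt hv)
    have hq := ((marcumQ_norm hσ hr).1 x).1
    have hv' : (0 : ℝ) < v := hv
    rw [hx] at hq
    have h1 : 0 ≤ Real.exp ((m : ℝ) * marcumQ (v / σ) (r / σ)) - 1 :=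
      sub_nonneg.2 (Real.one_le_exp (by positivity))
    have h2 : 0 ≤ 1 - Real.exp (-(m : ℝ)) := by simp
    unfold rayleighDensity
    positivity
  refine ⟨?_, ?_, hI1, ?_, hI2, ?_⟩
  · rw [meanNonemptyClusters_eq hΨ hA hA1]
    exact mul_ne_zero hV0 hE0
  · rw [meanNonemptyClusters_eq hΨ hA hA1]
    exact ENNReal.mul_ne_top (ENNReal.mul_ne_top ENNReal.coe_ne_top hA1)
      (ENNReal.sub_ne_top ENNReal.one_ne_top)
  · rw [hcontact, hvoid, ENNReal.toReal_ofReal (Real.exp_nonneg _)]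
  · rw [nearestNeighborCDF, refPointProb_nearest hlam hΨ hA hA0 hA1 hr, hav, hv, mul_div_assoc,
      hpick, hcontact, ENNReal.toReal_mul, ENNReal.toReal_ofReal hint0, sub_sub_cancel]
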